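/- **Setting.** For $k\ge 0$ let $l_k=\lfloor e^k\rfloor$ and $B_k=\{l_k,\dots,l_{k+1}-1\}$, so that the blocks $B_0,B_1,\dots$ partition $\{1,2,\dots\}$. Let $\{g_k\}_{k\ge0}$ be probability densities on $\mathbb R^+$ such that, for some constants $c_1,c_2,c_3>0$ and all $k\ge 0$, $$g_k(t)\ge e^{-c_1e^k}\ \text{ for } t\in[e^{-k^2},e^{-k}],\qquad \int_0^\infty t\,g_k(t)\,dt\le 4e^{-c_2k^2},\qquad \int_{e^{-k^2}}^\infty g_k(t)\,dt\le e^{-c_3e^k}.$$ The block prior $\bar\Pi$ is the law of the random sequence $\theta=(\theta_1,\theta_2,\dots)$ obtained by drawing $A_k\sim g_k$ independently and then, given $(A_k)$, drawing the blocks $(\theta_j)_{j\in B_k}\sim N(0,A_kI_{|B_k|})$ independently over $k$. In the Gaussian sequence model one observes $X_i=\theta_i+n^{-1/2}Z_i$, $i=1,2,\dots$, with $Z_i$ i.i.d. standard normal, that is, $X=(X_1,X_2,\dots)\sim P_\theta^{(n)}=\bigotimes_{i\ge1}N(\theta_i,n^{-1})$. For data $X\sim P^{(n)}_{\theta_0}$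 the posterior distribution is $$\bar\Pi(S\mid X)=\frac{\int_S \frac{p^{(n)}_\theta}{p^{(n)}_{\theta_0}}(X)\,d\bar\Pi(\theta)}{\int \frac{p^{(n)}_\theta}{p^{(n)}_{\theta_0}}(X)\,d\bar\Pi(\theta)},$$ where $(\theta,x)\mapsto \frac{p^{(n)}_\theta}{p^{(n)}_{\theta_0}}(x)$ is a jointly measurable version of the density of (the absolutely continuous part of) $P^{(n)}_\theta$ with respect to $P^{(n)}_{\theta_0}$. Let $\|\cdot\|$ be the $\ell^2$ norm (equal to $\infty$ for a sequence that is not square summable), let $E_\alpha(Q)=\{\theta:\sum_{j\ge1}j^{2\alpha}\theta_j^2\le Q^2\}$ be the Sobolev ball in terms of coefficients, and let $\epsilon_n=n^{-\alpha/(2\alpha+1)}$ be the minimax rate. **Theorem.** Let $\bar\Pi$ be the block prior with mixing densities $\{g_k\}$ as above, and let $\alpha>0$ and $Q>0$. For every $n\ge1$ and $\theta_0\in E_\alpha(Q)$ the posterior is well defined, that is, its denominator lies in $(0,\infty)$, $P^{(n)}_{\theta_0}$-almost surely; and there is a constant $M>0$ such that $$\sup_{\theta_0\in E_\alpha(Q)}P^{(n)}_{\theta_0}\,\bar\Pi\big(\|\theta-\theta_0\|>M\epsilon_n\mid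 X_1,X_2,\dots\big)\longrightarrow0\qquad(n\to\infty),$$ where $P^{(n)}_{\theta_0}$ denotes expectation over $X\sim P^{(n)}_{\theta_0}$. The prior depends on neither $\alpha$, $Q$ nor $n$. -/

import Mathlib

open MeasureTheory ProbabilityTheory Filter Topology
open scoped ENNReal NNReal

noncomputable section

namespace BlockPrior

/-! Sequences `(θ₁, θ₂, …)` are functions `ℕ → ℝ`; the coordinate `j : ℕ` is the entry `θ_{j+1}`. -/

/-- The product of Markov kernels depends measurably on the parameter. -/
theorem measurable_infinitePi {Ω : Type*} [MeasurableSpace Ω] (μ : Ω → ℕ → Measure ℝ)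
    [∀ a i, IsProbabilityMeasure (μ a i)] (hμ : ∀ i, Measurable fun a => μ a i) :
    Measurable fun a => Measure.infinitePi (μ a) := by
  refine Measurable.measure_of_isPiSystem_of_isProbabilityMeasure
    (generateFrom_squareCylinders (α := fun _ : ℕ => ℝ)).symm
    (isPiSystem_squareCylinders (fun _ => MeasurableSpace.isPiSystem_measurableSet) (by simp)) ?_
  rintro _ ⟨s, t, ht, rfl⟩
  have ht' : ∀ i, MeasurableSet (t i) := fun i => ht i (Set.mem_univ i)
  have h : ∀ a, Measure.infinitePi (μ a) ((s : Set ℕ).pi t) = ∏ i ∈ s, μ a i (t i) :=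
    fun a => Measure.infinitePi_pi (μ a) (fun i _ => ht' i)
  simp_rw [h]
  exact Finset.measurable_prod _ fun i _ => (Measure.measurable_coe (ht' i)).comp (hμ i)

/-! ### Blocks -/

/-- The first index `l_k = ⌊e^k⌋` of the `k`-th block `B_k = {l_k, …, l_{k+1} - 1}`. -/
def blockStart (k : ℕ) : ℕ := ⌊Real.exp k⌋₊

open Classical in
/-- The number `k` of the block `B_k` that contains `m ≥ 1`: the largest `k` with `l_k ≤ m`. -/
def blockIndex (m : ℕ) : ℕ := Nat.findGreatest (fun k => blockStart k ≤ m) m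

theorem blockStart_mono : Monotone blockStart := fun a b h =>
  Nat.floor_le_floor (Real.exp_le_exp.2 (by exact_mod_cast h))

theorem lt_blockStart (k : ℕ) : k < blockStart k := by
  refine Nat.lt_of_succ_le (Nat.le_floor ?_)
  push_cast
  exact Real.add_one_le_exp _

/-- `m ≥ 1` lies in `B_k` exactly when `k` is its block number. -/
theorem blockIndex_eq_iff {m : ℕ} (hm : 1 ≤ m) (k : ℕ) :
    blockIndex m = k ↔ m ∈ Finset.Ico (blockStart k) (blockStart (k + 1)) := by
  classical
  have h0 : blockStart 0 ≤ m := by simpa [blockStart] using hm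
  rw [Finset.mem_Ico]
  constructor
  · rintro rfl
    refine ⟨Nat.findGreatest_spec (P := fun k => blockStart k ≤ m) (Nat.zero_le m) h0, ?_⟩
    by_contra! h
    have h1 := Nat.le_findGreatest (P := fun k => blockStart k ≤ m)
      (le_of_lt ((lt_blockStart _).trans_le h)) h
    unfold blockIndex at h1
    convert Nat.not_succ_le_self _ h1
  · rintro ⟨h1, h2⟩
    apply le_antisymm
    · by_contra! h
      have h3 := Nat.findGreatest_spec (P := fun k => blockStart k ≤ m) (Nat.zero_le m) h0
      have h4 := blockStart_mono (Nat.succ_le_of_lt h)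
      unfold blockIndex at h4
      simp only [Nat.succ_eq_add_one] at h4
      have h5 := h4.trans h3
      omega
    · exact Nat.le_findGreatest (P := fun k => blockStart k ≤ m)
        (le_of_lt ((lt_blockStart _).trans_le h1)) h1

/-! ### Mixing densities -/

/-- A sequence of probability densities `g_k` on the positive half line (their values at `t ≤ 0`
play no role). -/
structure MixingDensities where
  dens : ℕ → ℝ → ℝ
  measurable_dens : ∀ k, Measurable (dens k)
  dens_nonneg : ∀ k t, 0 < t → 0 ≤ dens k t
  lintegral_dens : ∀ k, ∫⁻ t in Set.Ioi 0, ENNReal.ofReal (dens k t) = 1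

/-- The class `𝒢` of mixing densities. -/
structure InMixingClass (g : MixingDensities) : Prop where
  lower : ∃ c₁ : ℝ, 0 < c₁ ∧ ∀ k : ℕ,
    ∀ t ∈ Set.Icc (Real.exp (-(k : ℝ) ^ 2)) (Real.exp (-(k : ℝ))),
      Real.exp (-c₁ * Real.exp k) ≤ g.dens k t
  mean : ∃ c₂ : ℝ, 0 < c₂ ∧ ∀ k : ℕ,
    ∫⁻ t in Set.Ioi 0, ENNReal.ofReal (t * g.dens k t) ≤
      ENNReal.ofReal (4 * Real.exp (-c₂ * (k : ℝ) ^ 2))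
  tail : ∃ c₃ : ℝ, 0 < c₃ ∧ ∀ k : ℕ,
    ∫⁻ t in Set.Ioi (Real.exp (-(k : ℝ) ^ 2)), ENNReal.ofReal (g.dens k t) ≤
      ENNReal.ofReal (Real.exp (-c₃ * Real.exp k))

/-- The law of the scale `A_k`. -/
def MixingDensities.scaleLaw (g : MixingDensities) (k : ℕ) : Measure ℝ :=
  (volume.restrict (Set.Ioi 0)).withDensity fun t => ENNReal.ofReal (g.dens k t)

instance (g : MixingDensities) (k : ℕ) : IsProbabilityMeasure (g.scaleLaw k) :=
  ⟨by simpa [MixingDensities.scaleLaw] using g.lintegral_dens k⟩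

/-! ### The block prior -/

/-- The conditional law of `θ` given the scales `A = (A_k)`: the blocks are independent and the
`k`-th block is `N(0, A_k I)`, that is, the entries are independent and `θ_j ∼ N(0, A_k)` for
`j ∈ B_k`. -/
def blockGaussian : Kernel (ℕ → ℝ) (ℕ → ℝ) where
  toFun A := Measure.infinitePi fun j : ℕ =>
    gaussianReal 0 (Real.toNNReal (A (blockIndex (j + 1))))
  measurable' := measurable_infinitePi _ fun j => by
    have h : Measurable fun p : ℝ × ℝ≥0 => gaussianReal p.1 p.2 := measurable_gaussianReal
    exact h.comp (measurable_const.prodMk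
      (measurable_real_toNNReal.comp (measurable_pi_apply _)))

/-- The block prior `Π̄`: the `A_k ∼ g_k` are independent, and `θ` given `A` is block Gaussian. -/
def blockPrior (g : MixingDensities) : Measure (ℕ → ℝ) :=
  (Measure.infinitePi g.scaleLaw).bind blockGaussian

/-! ### The Gaussian sequence model and the posterior -/

/-- The Gaussian sequence model `P_θ^{(n)} = ⨂ᵢ N(θᵢ, 1/n)`. -/
def seqModel (n : ℕ) : Kernel (ℕ → ℝ) (ℕ → ℝ) where
  toFun θ := Measure.infinitePi fun i : ℕ => gaussianReal (θ i) (n : ℝ≥0)⁻¹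
  measurable' := measurable_infinitePi _ fun i => by
    have h : Measurable fun p : ℝ × ℝ≥0 => gaussianReal p.1 p.2 := measurable_gaussianReal
    have h' : Measurable fun θ : ℕ → ℝ => (θ i, (n : ℝ≥0)⁻¹) :=
      (measurable_pi_apply i).prodMk measurable_const
    exact h.comp h'

instance : IsMarkovKernel blockGaussian :=
  ⟨fun _ => inferInstanceAs (IsProbabilityMeasure (Measure.infinitePi _))⟩

instance (n : ℕ) : IsMarkovKernel (seqModel n) :=
  ⟨fun _ => inferInstanceAs (IsProbabilityMeasure (Measure.infinitePi _))⟩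

/-- The likelihood ratio `(p_θ^{(n)} / p_{θ₀}^{(n)})(x)`, as a jointly measurable version in
`(θ, x)` of the Radon-Nikodym derivative of `P_θ^{(n)}` with respect to `P_{θ₀}^{(n)}`. -/
def likelihoodRatio (n : ℕ) (θ₀ θ x : ℕ → ℝ) : ℝ≥0∞ :=
  Kernel.rnDeriv (seqModel n) (Kernel.const (ℕ → ℝ) (seqModel n θ₀)) θ x

/-- The denominator `∫ (p_θ / p_{θ₀})(x) dΠ(θ)` of the posterior. -/
def evidence (n : ℕ) (prior : Measure (ℕ → ℝ)) (θ₀ x : ℕ → ℝ) : ℝ≥0∞ :=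
  ∫⁻ θ, likelihoodRatio n θ₀ θ x ∂prior

/-- The posterior probability `Π(S | x)` under the data distribution `P_{θ₀}^{(n)}`. -/
def posteriorProb (n : ℕ) (prior : Measure (ℕ → ℝ)) (θ₀ : ℕ → ℝ) (S : Set (ℕ → ℝ)) (x : ℕ → ℝ) :
    ℝ≥0∞ :=
  (∫⁻ θ in S, likelihoodRatio n θ₀ θ x ∂prior) / evidence n prior θ₀ x

/-! ### Norm, Sobolev balls and the rate -/

/-- The `ℓ²` norm of a real sequence, `∞` if the sequence is not square summable. -/
def l2Norm (v : ℕ → ℝ) : ℝ≥0∞ := (∑' j, ENNReal.ofReal (v j ^ 2)) ^ (1 / 2 : ℝ)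

/-- The Sobolev ball `E_α(Q)`, in terms of coefficients: `∑_{j ≥ 1} j^{2α} θ_j² ≤ Q²`. -/
def sobolevBall (α Q : ℝ) : Set (ℕ → ℝ) :=
  {θ | ∑' j : ℕ, ENNReal.ofReal (((j : ℝ) + 1) ^ (2 * α) * θ j ^ 2) ≤ ENNReal.ofReal (Q ^ 2)}

/-- The minimax rate `ε_n`, with `ε_n² = n^{-2α/(2α+1)}`. -/
def rate (α : ℝ) (n : ℕ) : ℝ := (n : ℝ) ^ (-α / (2 * α + 1))

end BlockPrior

end

namespace BlockPrior

/-! Put r = n^{1/(2α+1)}, so that ε_n² = r^{-2α} and nε_n² = r. Contraction follows from three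
estimates at exponential scale r, uniform over the Sobolev ball.

Prior mass (`exists_blockPrior_nhd_ge`): an ℓ² ball of squared radius of order r^{-2α} has mass at
least e^{-Cr}. For e^k up to r, the scale A_k falls near e^{-(2α+1)k} at total cost e^{-Kr}. Given
such scales the first D ≤ r coordinates match θ₀ within r^{-(2α+1)/2} at a further cost e^{-C₃r}.
The remaining coordinates are small by Markov's inequality and the mean condition on g_k.

Sieve (`exists_blockPrior_tail_le`): up to prior mass of order e^{-Lr}, the coordinates beyond a
multiple of r have squared norm of order r^{-2α}. The tail condition gives A_k ≤ e^{-k²} on all late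
blocks, and a Chernoff bound handles the Gaussian part.

Test: on the first O(r) coordinates, reject when the squared distance from X to θ₀ exceeds a
multiple of r^{-2α}. Both errors are chi-square deviations, at most e^{-Lr}.

The evidence is bounded below without Kullback-Leibler neighbourhoods. The inequality P_{θ₀}(E)² ≤
e^{n‖θ-θ₀‖²} P_θ(E) (`sq_seqModel_le`), integrated over the neighbourhood, bounds the probability of
small evidence directly. `lintegral_posteriorProb_le` combines the pieces. -/

theorem lintegral_prod_infinitePi {μ : ℕ → Measure ℝ} [∀ i, IsProbabilityMeasure (μ i)]
    (s : Finset ℕ) {f : ℕ → ℝ → ℝ≥0∞} (hf : ∀ i, Measurable (f i)) :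
    ∫⁻ x, ∏ i ∈ s, f i (x i) ∂(Measure.infinitePi μ) = ∏ i ∈ s, ∫⁻ y, f i y ∂(μ i) := by
  rw [lintegral_prod_eq_prod_lintegral_of_indepFun s (fun i (x : ℕ → ℝ) => f i (x i))
    (iIndepFun_infinitePi hf) (fun i => (hf i).comp (measurable_pi_apply i))]
  refine Finset.prod_congr rfl fun i _ => ?_
  rw [← (measurePreserving_eval_infinitePi μ i).lintegral_comp (hf i)]

/-! ### One-dimensional Gaussian facts -/

theorem gaussianReal_eq_withDensity_shift (m m' : ℝ) {v : ℝ≥0} (hv : v ≠ 0) :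
    gaussianReal m v = (gaussianReal m' v).withDensity fun x =>
      ENNReal.ofReal (Real.exp ((m - m') * (x - m') / v - (m - m') ^ 2 / (2 * v))) := by
  rw [gaussianReal_of_var_ne_zero m hv, gaussianReal_of_var_ne_zero m' hv,
    ← withDensity_mul _ (measurable_gaussianPDF m' v) (by fun_prop)]
  congr 1
  ext x
  have hv' : (v : ℝ) ≠ 0 := by exact_mod_cast hv
  simp only [Pi.mul_apply, gaussianPDF, gaussianPDFReal]
  rw [← ENNReal.ofReal_mul (by positivity), mul_assoc (√(2 * Real.pi * v))⁻¹, ← Real.exp_add]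
  congr 3
  field_simp
  ring

theorem lintegral_shift_density_sq (m m' : ℝ) {v : ℝ≥0} (hv : v ≠ 0) :
    ∫⁻ x, (ENNReal.ofReal (Real.exp ((m - m') * (x - m') / v - (m - m') ^ 2 / (2 * v)))) ^ 2
      ∂(gaussianReal m' v) = ENNReal.ofReal (Real.exp ((m - m') ^ 2 / v)) := by
  have hv' : (v : ℝ) ≠ 0 := by exact_mod_cast hv
  have h : ∀ x : ℝ,
      (ENNReal.ofReal (Real.exp ((m - m') * (x - m') / v - (m - m') ^ 2 / (2 * v)))) ^ 2 =
      ENNReal.ofReal (Real.exp (-(2 * (m - m') * m' / v) - (m - m') ^ 2 / v) *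
        Real.exp (2 * (m - m') / v * x)) := by
    intro x
    rw [← ENNReal.ofReal_pow (Real.exp_nonneg _), ← Real.exp_nat_mul, ← Real.exp_add]
    congr 2
    push_cast
    field_simp
    ring
  simp_rw [h]
  rw [← ofReal_integral_eq_lintegral_ofReal ((integrable_exp_mul_gaussianReal _).const_mul _)
    (ae_of_all _ fun x => by positivity), integral_const_mul]
  have := congrFun (mgf_fun_id_gaussianReal (μ := m') (v := v)) (2 * (m - m') / v)
  rw [mgf] at this
  rw [this, ← Real.exp_add]
  congr 2
  field_simp
  ring

theorem exp_neg_four_mul_le {u : ℝ} (h0 : 0 ≤ u) (h1 : u ≤ 1 / 4) :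
    Real.exp (-(4 * u)) ≤ 1 - 2 * u := by
  rw [Real.exp_neg, inv_le_comm₀ (Real.exp_pos _) (by linarith)]
  refine le_trans ?_ (Real.add_one_le_exp _)
  rw [inv_le_iff_one_le_mul₀ (by linarith)]
  nlinarith

/-- Tilting the N(m, v) density by e^{l(x-m)²} gives (1-2lv)^{-1/2} times the density of N(m,
v/(1-2lv)). The factor is at most e^{2lv} by `exp_neg_four_mul_le`. -/
theorem lintegral_exp_sq_gaussianReal_le (m : ℝ) (v : ℝ≥0) {l : ℝ} (hl : 0 ≤ l)
    (hlv : l * v ≤ 1 / 4) :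
    ∫⁻ x, ENNReal.ofReal (Real.exp (l * (x - m) ^ 2)) ∂(gaussianReal m v) ≤
      ENNReal.ofReal (Real.exp (2 * l * v)) := by
  rcases eq_or_ne v 0 with rfl | hv
  · simp
  have hv0 : (0 : ℝ) < v := by exact_mod_cast pos_iff_ne_zero.2 hv
  have hd : 0 < 1 - 2 * (l * v) := by linarith
  set w : ℝ≥0 := v / Real.toNNReal (1 - 2 * (l * v)) with hw
  have hwv : (w : ℝ) = v / (1 - 2 * (l * v)) := by
    rw [hw, NNReal.coe_div, Real.coe_toNNReal _ hd.le]
  have hw0 : (0 : ℝ) < w := by rw [hwv]; positivity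
  have hwne : w ≠ 0 := by
    intro h
    rw [h] at hw0
    simp at hw0
  rw [gaussianReal_of_var_ne_zero m hv,
    lintegral_withDensity_eq_lintegral_mul _ (measurable_gaussianPDF m v) (by fun_prop)]
  have h : ∀ x, (gaussianPDF m v * fun x => ENNReal.ofReal (Real.exp (l * (x - m) ^ 2))) x =
      ENNReal.ofReal (√(1 - 2 * (l * v)))⁻¹ * gaussianPDF m w x := by
    intro x
    simp only [Pi.mul_apply, gaussianPDF, gaussianPDFReal]
    rw [← ENNReal.ofReal_mul (by positivity), ← ENNReal.ofReal_mul (by positivity), mul_assoc,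
      ← Real.exp_add, ← mul_assoc]
    congr 2
    · rw [hwv, ← mul_inv, ← Real.sqrt_mul hd.le]
      congr 2
      generalize 1 - 2 * (l * (v : ℝ)) = d at hd
      field_simp
    · rw [hwv]
      congr 1
      field_simp
      ring
  simp_rw [h]
  rw [lintegral_const_mul _ (measurable_gaussianPDF m w), lintegral_gaussianPDF_eq_one m hwne,
    mul_one]
  refine ENNReal.ofReal_le_ofReal ?_
  rw [inv_le_comm₀ (Real.sqrt_pos.2 hd) (Real.exp_pos _), ← Real.exp_neg]
  refine Real.le_sqrt_of_sq_le ?_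
  rw [← Real.exp_nat_mul]
  refine le_trans (le_of_eq ?_) (exp_neg_four_mul_le (mul_nonneg hl hv0.le) hlv)
  congr 1
  push_cast
  ring

/-- Interval length times a lower bound for the density, from √(2π) ≤ 4 and x² ≤ 2(t² + η²) on the
interval. -/
theorem gaussianReal_Icc_ge {v : ℝ≥0} (hv : v ≠ 0) (t : ℝ) (η : ℝ) :
    ENNReal.ofReal (η / (2 * √v) * Real.exp (-((t ^ 2 + η ^ 2) / v))) ≤
      gaussianReal 0 v (Set.Icc (t - η) (t + η)) := by
  have hv0 : (0 : ℝ) < v := by exact_mod_cast pos_iff_ne_zero.2 hv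
  rw [gaussianReal_apply 0 hv]
  calc ENNReal.ofReal (η / (2 * √v) * Real.exp (-((t ^ 2 + η ^ 2) / v)))
      ≤ ENNReal.ofReal ((4 * √v)⁻¹ * Real.exp (-((t ^ 2 + η ^ 2) / v))) *
          volume (Set.Icc (t - η) (t + η)) := by
        rw [Real.volume_Icc, ← ENNReal.ofReal_mul (by positivity)]
        refine ENNReal.ofReal_le_ofReal (le_of_eq ?_)
        have : √(v : ℝ) ≠ 0 := (Real.sqrt_pos.2 hv0).ne'
        field_simp
        ring
    _ = ∫⁻ x in Set.Icc (t - η) (t + η),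
          ENNReal.ofReal ((4 * √v)⁻¹ * Real.exp (-((t ^ 2 + η ^ 2) / v))) := by
        rw [setLIntegral_const]
    _ ≤ _ := by
        refine setLIntegral_mono (measurable_gaussianPDF 0 v) fun x hx => ?_
        refine ENNReal.ofReal_le_ofReal ?_
        rw [gaussianPDFReal]
        gcongr
        · rw [Real.sqrt_mul (by positivity)]
          gcongr
          rw [Real.sqrt_le_left (by norm_num)]
          linarith [Real.pi_le_four]
        · rw [neg_div, neg_le_neg_iff, div_le_div_iff₀ (by positivity) hv0]
          have h1 : (x - 0) ^ 2 ≤ 2 * (t ^ 2 + η ^ 2) := by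
            obtain ⟨h1, h2⟩ := hx
            have h3 : (x - t) ^ 2 ≤ η ^ 2 := sq_le_sq' (by linarith) (by linarith)
            nlinarith [sq_nonneg (x - 2 * t)]
          nlinarith

theorem lintegral_sq_gaussianReal (v : ℝ≥0) :
    ∫⁻ x, ENNReal.ofReal (x ^ 2) ∂(gaussianReal 0 v) = v := by
  have h1 := variance_fun_id_gaussianReal (μ := 0) (v := v)
  have h2 : MemLp (fun x : ℝ => x) 2 (gaussianReal 0 v) := memLp_id_gaussianReal 2
  rw [variance_eq_integral (by fun_prop), integral_id_gaussianReal] at h1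
  rw [← ofReal_integral_eq_lintegral_ofReal h2.integrable_sq (ae_of_all _ fun x => sq_nonneg x)]
  simp only [sub_zero] at h1
  rw [h1, ENNReal.ofReal_coe_nnreal]

/-! ### A Chernoff bound for sums of squares -/

theorem infinitePi_gaussianReal_sum_sq_gt_le (m : ℕ → ℝ) (v : ℕ → ℝ≥0) (s : Finset ℕ) {l : ℝ}
    (hl : 0 ≤ l) (hlv : ∀ j ∈ s, l * v j ≤ 1 / 4) (u : ℝ) :
    Measure.infinitePi (fun j => gaussianReal (m j) (v j)) {x | u < ∑ j ∈ s, (x j - m j) ^ 2} ≤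
      ENNReal.ofReal (Real.exp (-(l * u) + 2 * l * ∑ j ∈ s, (v j : ℝ))) := by
  set P := Measure.infinitePi (fun j => gaussianReal (m j) (v j))
  have h1 : {x : ℕ → ℝ | u < ∑ j ∈ s, (x j - m j) ^ 2} ⊆ {x | ENNReal.ofReal (Real.exp (l * u)) ≤
      ∏ j ∈ s, ENNReal.ofReal (Real.exp (l * (x j - m j) ^ 2))} := by
    intro x hx
    simp only [Set.mem_ofPred_eq] at hx ⊢
    rw [← ENNReal.ofReal_prod_of_nonneg (fun _ _ => Real.exp_nonneg _), ← Real.exp_sum,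
      ← Finset.mul_sum]
    gcongr
  have h2 : ∫⁻ x, ∏ j ∈ s, ENNReal.ofReal (Real.exp (l * (x j - m j) ^ 2)) ∂P ≤
      ENNReal.ofReal (Real.exp (2 * l * ∑ j ∈ s, (v j : ℝ))) := by
    rw [lintegral_prod_infinitePi s (f := fun j y => ENNReal.ofReal (Real.exp (l * (y - m j) ^ 2)))
      (fun i => by fun_prop), Finset.mul_sum, Real.exp_sum,
      ENNReal.ofReal_prod_of_nonneg (fun _ _ => Real.exp_nonneg _)]
    exact Finset.prod_le_prod' fun j hj => lintegral_exp_sq_gaussianReal_le _ _ hl (hlv j hj)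
  refine (measure_mono h1).trans ((meas_ge_le_lintegral_div ?_ ?_ ENNReal.ofReal_ne_top).trans ?_)
  · exact (Finset.measurable_prod _ fun j _ => by fun_prop).aemeasurable
  · simp [Real.exp_pos]
  · refine ENNReal.div_le_of_le_mul (h2.trans ?_)
    rw [← ENNReal.ofReal_mul (Real.exp_nonneg _), ← Real.exp_add]
    refine ENNReal.ofReal_le_ofReal (Real.exp_le_exp.2 (le_of_eq (by ring)))

/-! ### Comparison of product measures on all events -/

/-- Changing only finitely many factors has an explicit density. On events depending on the
coordinates in `I` the modified measure agrees with the full product of the `μ i`, so no infinite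
product of densities is needed. -/
theorem infinitePi_ite_eq_withDensity {μ ν : ℕ → Measure ℝ} [∀ i, IsProbabilityMeasure (μ i)]
    [∀ i, IsProbabilityMeasure (ν i)] {g : ℕ → ℝ → ℝ≥0∞} (hg : ∀ i, Measurable (g i))
    (hμ : ∀ i, μ i = (ν i).withDensity (g i)) (I : Finset ℕ)
    [∀ i, IsProbabilityMeasure (if i ∈ I then μ i else ν i)] :
    (Measure.infinitePi ν).withDensity (fun x => ∏ i ∈ I, g i (x i)) =
      Measure.infinitePi fun i => if i ∈ I then μ i else ν i := by
  refine Measure.eq_infinitePi _ fun s t ht => ?_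
  have hmeas : MeasurableSet ((s : Set ℕ).pi t) :=
    MeasurableSet.pi s.countable_toSet fun i _ => ht i
  rw [withDensity_apply _ hmeas, ← lintegral_indicator hmeas]
  let f : ℕ → ℝ → ℝ≥0∞ := fun i y =>
    (if i ∈ s then (t i).indicator 1 y else 1) * (if i ∈ I then g i y else 1)
  have hf : ∀ i, Measurable (f i) := by
    intro i
    refine Measurable.mul ?_ ?_
    · split_ifs
      · exact measurable_one.indicator (ht i)
      · exact measurable_const
    · split_ifs
      · exact hg i
      · exact measurable_const
  have h1 : ∀ x : ℕ → ℝ, ((s : Set ℕ).pi t).indicator (fun x => ∏ i ∈ I, g i (x i)) x =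
      ∏ i ∈ s ∪ I, f i (x i) := by
    intro x
    simp only [f]
    rw [Finset.prod_mul_distrib, Finset.prod_ite_mem, Finset.prod_ite_mem,
      Finset.union_inter_cancel_left, Finset.union_inter_cancel_right]
    by_cases hx : x ∈ (s : Set ℕ).pi t
    · rw [Set.indicator_of_mem hx, Finset.prod_eq_one (s := s), one_mul]
      intro i hi
      rw [Set.indicator_of_mem (hx i hi), Pi.one_apply]
    · rw [Set.indicator_of_notMem hx]
      simp only [Set.mem_pi, not_forall] at hx
      obtain ⟨i, hi, hxi⟩ := hx
      rw [Finset.prod_eq_zero (i := i) hi (Set.indicator_of_notMem hxi _), zero_mul]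
  simp_rw [h1]
  rw [lintegral_prod_infinitePi _ hf]
  have h2 : ∀ i, ∫⁻ y, f i y ∂(ν i) =
      if i ∈ s then (if i ∈ I then μ i else ν i) (t i) else 1 := by
    intro i
    by_cases hs : i ∈ s <;> by_cases hI : i ∈ I
    · simp only [f, hs, hI, if_true]
      rw [hμ i, withDensity_apply _ (ht i), ← lintegral_indicator (ht i)]
      refine lintegral_congr fun y => ?_
      by_cases hy : y ∈ t i <;> simp [hy]
    · simp only [f, hs, hI, if_true, if_false, mul_one]
      exact lintegral_indicator_one (ht i)
    · simp only [f, hs, hI, if_true, if_false, one_mul]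
      have := measure_univ (μ := μ i)
      rwa [hμ i, withDensity_apply _ .univ, setLIntegral_univ] at this
    · simp [f, hs, hI]
  simp_rw [h2]
  rw [Finset.prod_ite_mem, Finset.union_inter_cancel_left]

theorem sq_withDensity_le {X : Type*} [MeasurableSpace X] (P : Measure X) {r : X → ℝ≥0∞}
    (hr : Measurable r) {E : Set X} (hE : MeasurableSet E) :
    (P.withDensity r E) ^ 2 ≤ (∫⁻ x, r x ^ 2 ∂P) * P E := by
  rw [withDensity_apply _ hE, ← lintegral_indicator hE]
  have h := ENNReal.lintegral_mul_le_Lp_mul_Lq P (Real.HolderConjugate.two_two)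
    hr.aemeasurable ((measurable_one (α := ℝ≥0∞)).indicator hE).aemeasurable
  have h2 : ∀ x, E.indicator (1 : X → ℝ≥0∞) x ^ (2 : ℝ) = E.indicator 1 x := by
    intro x
    by_cases hx : x ∈ E <;> simp [hx]
  simp_rw [h2] at h
  rw [lintegral_indicator_one hE] at h
  have h3 : ∫⁻ a, E.indicator r a ∂P = ∫⁻ a, (r * E.indicator (1 : X → ℝ≥0∞)) a ∂P := by
    refine lintegral_congr fun x => ?_
    by_cases hx : x ∈ E <;> simp [hx]
  rw [h3]
  refine (pow_le_pow_left' h 2).trans (le_of_eq ?_)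
  rw [mul_pow, ← ENNReal.rpow_natCast, ← ENNReal.rpow_natCast, ← ENNReal.rpow_mul,
    ← ENNReal.rpow_mul]
  norm_num

/-- Cauchy-Schwarz gives the bound on cylinders, with a constant independent of the cylinder.
Approximation by cylinders then carries it to every event, which bypasses Kakutani's theorem. -/
theorem sq_infinitePi_le {μ ν : ℕ → Measure ℝ} [∀ i, IsProbabilityMeasure (μ i)]
    [∀ i, IsProbabilityMeasure (ν i)] {g : ℕ → ℝ → ℝ≥0∞} (hg : ∀ i, Measurable (g i))
    (hμ : ∀ i, μ i = (ν i).withDensity (g i)) {C : ℝ≥0∞} (hC : C ≠ ∞)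
    (hgC : ∀ I : Finset ℕ, ∏ i ∈ I, ∫⁻ y, g i y ^ 2 ∂(ν i) ≤ C)
    {E : Set (ℕ → ℝ)} (hE : MeasurableSet E) :
    (Measure.infinitePi μ E) ^ 2 ≤ C * Measure.infinitePi ν E := by
  have hcyl : ∀ F ∈ measurableCylinders (fun _ : ℕ => ℝ),
      (Measure.infinitePi μ F) ^ 2 ≤ C * Measure.infinitePi ν F := by
    intro F hF
    obtain ⟨I, S, hS, rfl⟩ := (mem_measurableCylinders F).1 hF
    have : ∀ i, IsProbabilityMeasure (if i ∈ I then μ i else ν i) := by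
      intro i; split_ifs <;> infer_instance
    have h1 : Measure.infinitePi μ (cylinder I S) =
        (Measure.infinitePi ν).withDensity (fun x => ∏ i ∈ I, g i (x i)) (cylinder I S) := by
      rw [infinitePi_ite_eq_withDensity hg hμ I, Measure.infinitePi_cylinder _ hS,
        Measure.infinitePi_cylinder _ hS]
      congr 2
      ext1 i
      simp
    rw [h1]
    refine (sq_withDensity_le _ ?_ (hS.cylinder I)).trans ?_
    · exact Finset.measurable_prod _ fun i _ => (hg i).comp (measurable_pi_apply i)
    gcongr
    simp_rw [← Finset.prod_pow]
    rw [lintegral_prod_infinitePi I (f := fun i y => g i y ^ 2) (fun i => (hg i).pow_const 2)]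
    exact hgC I
  set P := Measure.infinitePi μ
  set R := Measure.infinitePi ν
  have happ : ∀ ε : ℝ≥0, 0 < ε → P E ^ 2 ≤ C * (R E + ε) + 3 * ε := by
    intro ε hε
    -- Approximating in the sum `P + R` makes one cylinder close to `E` under both measures. The
    -- accuracy is capped at 1 so that the error from squaring is at most 3ε.
    obtain ⟨F, hF, hFE⟩ := exists_measure_symmDiff_lt_of_generateFrom_isSetRing (μ := P + R)
      (isSetRing_measurableCylinders (α := fun _ : ℕ => ℝ))
      ⟨{Set.univ}, Set.countable_singleton _, by
        simpa using (isSetAlgebra_measurableCylinders (α := fun _ : ℕ => ℝ)).univ_mem, by simp⟩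
      (generateFrom_measurableCylinders (α := fun _ : ℕ => ℝ)).symm hE
      (ε := (min ε 1 : ℝ≥0)) (by simpa using hε)
    rw [Measure.add_apply] at hFE
    have hP : P (symmDiff F E) ≤ (min ε 1 : ℝ≥0) := le_self_add.trans hFE.le
    have hR : R (symmDiff F E) ≤ ε :=
      (le_add_self.trans hFE.le).trans (by exact_mod_cast min_le_left _ _)
    have hP1 : P E ≤ P F + (min ε 1 : ℝ≥0) := by
      refine (measure_mono (t := F ∪ symmDiff F E) fun x hx => ?_).trans
        ((measure_union_le _ _).trans (by gcongr))
      by_cases hxF : x ∈ F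
      · exact Or.inl hxF
      · exact Or.inr (Or.inr ⟨hx, hxF⟩)
    have hR1 : R F ≤ R E + ε := by
      refine (measure_mono (t := E ∪ symmDiff F E) fun x hx => ?_).trans
        ((measure_union_le _ _).trans (by gcongr))
      by_cases hxE : x ∈ E
      · exact Or.inl hxE
      · exact Or.inr (Or.inl ⟨hx, hxE⟩)
    calc P E ^ 2 ≤ (P F + (min ε 1 : ℝ≥0)) ^ 2 := by gcongr
      _ = P F ^ 2 + (2 * P F + (min ε 1 : ℝ≥0)) * (min ε 1 : ℝ≥0) := by ring
      _ ≤ C * R F + (2 * 1 + 1) * ε := by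
          gcongr
          · exact hcyl F hF
          · exact prob_le_one
          · exact_mod_cast min_le_right _ _
          · exact_mod_cast min_le_left _ _
      _ ≤ C * (R E + ε) + 3 * ε := by
          gcongr
          norm_num
  have hlim : Tendsto (fun ε : ℝ≥0 => C * (R E + ε) + 3 * (ε : ℝ≥0∞)) (𝓝[>] 0)
      (𝓝 (C * (R E + (0 : ℝ≥0)) + 3 * ((0 : ℝ≥0) : ℝ≥0∞))) := by
    refine Tendsto.mono_left ?_ nhdsWithin_le_nhds
    have hc : Tendsto (fun ε : ℝ≥0 => (ε : ℝ≥0∞)) (𝓝 0) (𝓝 ((0 : ℝ≥0) : ℝ≥0∞)) :=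
      ENNReal.continuous_coe.tendsto 0
    exact (ENNReal.Tendsto.const_mul (tendsto_const_nhds.add hc) (Or.inr hC)).add
      (ENNReal.Tendsto.const_mul hc (Or.inr (by norm_num)))
  have := ge_of_tendsto hlim (eventually_mem_nhdsWithin.mono fun ε hε => happ ε hε)
  simpa using this

/-- The chi-square bound between two Gaussian sequence models. -/
theorem sq_seqModel_le {n : ℕ} (hn : 1 ≤ n) (θ₀ θ : ℕ → ℝ) {R : ℝ}
    (hR : ∀ I : Finset ℕ, ∑ i ∈ I, (θ₀ i - θ i) ^ 2 ≤ R) {E : Set (ℕ → ℝ)}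
    (hE : MeasurableSet E) :
    (seqModel n θ₀ E) ^ 2 ≤ ENNReal.ofReal (Real.exp (n * R)) * seqModel n θ E := by
  have hv : (n : ℝ≥0)⁻¹ ≠ 0 := by
    have : (n : ℝ≥0) ≠ 0 := by exact_mod_cast (by omega : n ≠ 0)
    exact inv_ne_zero this
  refine sq_infinitePi_le (μ := fun i => gaussianReal (θ₀ i) (n : ℝ≥0)⁻¹)
    (ν := fun i => gaussianReal (θ i) (n : ℝ≥0)⁻¹) (fun i => by fun_prop)
    (fun i => gaussianReal_eq_withDensity_shift (θ₀ i) (θ i) hv) ENNReal.ofReal_ne_top ?_ hE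
  intro I
  simp_rw [lintegral_shift_density_sq _ _ hv]
  rw [← ENNReal.ofReal_prod_of_nonneg (fun _ _ => Real.exp_nonneg _), ← Real.exp_sum]
  refine ENNReal.ofReal_le_ofReal (Real.exp_le_exp.2 ?_)
  rw [← Finset.sum_div, NNReal.coe_inv, div_inv_eq_mul, mul_comm]
  simpa using mul_le_mul_of_nonneg_left (hR I) (Nat.cast_nonneg n)

/-! ### The posterior distribution for a general prior -/

theorem measurable_likelihoodRatio (n : ℕ) (θ₀ : ℕ → ℝ) :
    Measurable fun p : (ℕ → ℝ) × (ℕ → ℝ) => likelihoodRatio n θ₀ p.1 p.2 :=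
  Kernel.measurable_rnDeriv _ _

/-- Only an inequality, since the model at a general θ may have a part singular to the one at θ₀. It
suffices for numerators and for finiteness of the evidence. -/
theorem setLIntegral_likelihoodRatio_le (n : ℕ) (θ₀ θ : ℕ → ℝ) {E : Set (ℕ → ℝ)}
    (hE : MeasurableSet E) :
    ∫⁻ x in E, likelihoodRatio n θ₀ θ x ∂(seqModel n θ₀) ≤ seqModel n θ E :=
  Kernel.setLIntegral_rnDeriv_le (κ := seqModel n)
    (η := Kernel.const (ℕ → ℝ) (seqModel n θ₀)) (a := θ) hE

/-- At finite ℓ² distance the chi-square bound, with the roles of θ and θ₀ exchanged, yields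
absolute continuity and hence equality. -/
theorem setLIntegral_likelihoodRatio {n : ℕ} (hn : 1 ≤ n) {θ₀ θ : ℕ → ℝ} {R : ℝ}
    (hR : ∀ I : Finset ℕ, ∑ i ∈ I, (θ i - θ₀ i) ^ 2 ≤ R) {E : Set (ℕ → ℝ)}
    (hE : MeasurableSet E) :
    ∫⁻ x in E, likelihoodRatio n θ₀ θ x ∂(seqModel n θ₀) = seqModel n θ E := by
  refine Kernel.setLIntegral_rnDeriv (κ := seqModel n)
    (η := Kernel.const (ℕ → ℝ) (seqModel n θ₀)) (a := θ) ?_ hE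
  rw [Kernel.const_apply]
  refine Measure.AbsolutelyContinuous.mk fun s hs h0 => ?_
  have := sq_seqModel_le hn θ θ₀ hR hs
  rw [h0, mul_zero] at this
  simpa using this

theorem measurable_setLIntegral_likelihoodRatio (n : ℕ) (prior : Measure (ℕ → ℝ)) [SFinite prior]
    (θ₀ : ℕ → ℝ) (B : Set (ℕ → ℝ)) :
    Measurable fun x => ∫⁻ θ in B, likelihoodRatio n θ₀ θ x ∂prior :=
  (measurable_likelihoodRatio n θ₀).lintegral_prod_left

/-- The part of the evidence coming from a neighbourhood of the truth is rarely small. -/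
theorem measure_evidence_le_mul_le {n : ℕ} (hn : 1 ≤ n) (prior : Measure (ℕ → ℝ))
    [SFinite prior] (θ₀ : ℕ → ℝ) {R : ℝ} {B : Set (ℕ → ℝ)} (hB : MeasurableSet B)
    (hR : ∀ θ ∈ B, ∀ I : Finset ℕ, ∑ i ∈ I, (θ i - θ₀ i) ^ 2 ≤ R) (c : ℝ≥0∞) :
    seqModel n θ₀ {x | ∫⁻ θ in B, likelihoodRatio n θ₀ θ x ∂prior ≤ c} * prior B ≤
      ENNReal.ofReal (Real.exp (n * R)) * c := by
  set E := {x | ∫⁻ θ in B, likelihoodRatio n θ₀ θ x ∂prior ≤ c} with hEdef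
  have hE : MeasurableSet E :=
    measurableSet_le (measurable_setLIntegral_likelihoodRatio n prior θ₀ B) measurable_const
  -- The chi-square bound is integrated over `B`. After Fubini the inner integral is at most `c` on
  -- `E`, leaving a factor P_{θ₀}(E) that cancels one of the two on the left.
  have h1 : seqModel n θ₀ E ^ 2 * prior B ≤
      ENNReal.ofReal (Real.exp (n * R)) * (c * seqModel n θ₀ E) := by
    calc seqModel n θ₀ E ^ 2 * prior B = ∫⁻ _ in B, seqModel n θ₀ E ^ 2 ∂prior := by
          rw [setLIntegral_const]
      _ ≤ ∫⁻ θ in B, ENNReal.ofReal (Real.exp (n * R)) *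
            ∫⁻ x in E, likelihoodRatio n θ₀ θ x ∂(seqModel n θ₀) ∂prior := by
          refine setLIntegral_mono' hB fun θ hθ => ?_
          rw [setLIntegral_likelihoodRatio hn (hR θ hθ) hE]
          refine sq_seqModel_le hn θ₀ θ (fun I => ?_) hE
          refine le_trans (le_of_eq ?_) (hR θ hθ I)
          exact Finset.sum_congr rfl fun i _ => by ring
      _ = ENNReal.ofReal (Real.exp (n * R)) *
            ∫⁻ x in E, ∫⁻ θ in B, likelihoodRatio n θ₀ θ x ∂prior ∂(seqModel n θ₀) := by
          rw [lintegral_const_mul' _ _ ENNReal.ofReal_ne_top, lintegral_lintegral_swap]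
          exact (measurable_likelihoodRatio n θ₀).aemeasurable
      _ ≤ ENNReal.ofReal (Real.exp (n * R)) * ∫⁻ _ in E, c ∂(seqModel n θ₀) := by
          gcongr 1
          exact setLIntegral_mono' hE fun x hx => hx
      _ = _ := by rw [setLIntegral_const]
  rcases eq_or_ne (seqModel n θ₀ E) 0 with h0 | h0
  · rw [h0, zero_mul]; exact zero_le
  · refine (ENNReal.mul_le_mul_iff_right h0 (measure_ne_top _ _)).1 ?_
    calc _ = seqModel n θ₀ E ^ 2 * prior B := by ring
      _ ≤ _ := h1
      _ = _ := by ring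

/-- Positivity is the case `c = 0` of the small-evidence bound. Finiteness holds because the
evidence has expectation at most 1. -/
theorem ae_evidence_pos_lt_top {n : ℕ} (hn : 1 ≤ n) (prior : Measure (ℕ → ℝ))
    [IsProbabilityMeasure prior] (θ₀ : ℕ → ℝ) {R : ℝ} {B : Set (ℕ → ℝ)} (hB : MeasurableSet B)
    (hR : ∀ θ ∈ B, ∀ I : Finset ℕ, ∑ i ∈ I, (θ i - θ₀ i) ^ 2 ≤ R) (hpos : prior B ≠ 0) :
    ∀ᵐ x ∂(seqModel n θ₀), 0 < evidence n prior θ₀ x ∧ evidence n prior θ₀ x < ∞ := by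
  have h1 := measure_evidence_le_mul_le hn prior θ₀ hB hR 0
  rw [mul_zero, nonpos_iff_eq_zero, mul_eq_zero, or_iff_left hpos] at h1
  have hm : Measurable fun x => evidence n prior θ₀ x :=
    (measurable_likelihoodRatio n θ₀).lintegral_prod_left
  have h2 : ∫⁻ x, evidence n prior θ₀ x ∂(seqModel n θ₀) ≠ ∞ := by
    unfold evidence
    rw [lintegral_lintegral_swap (f := fun x θ => likelihoodRatio n θ₀ θ x)
      ((measurable_likelihoodRatio n θ₀).comp measurable_swap).aemeasurable]
    refine ne_top_of_le_ne_top (b := ∫⁻ _, 1 ∂prior) (by simp) (lintegral_mono fun θ => ?_)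
    have := setLIntegral_likelihoodRatio_le n θ₀ θ MeasurableSet.univ
    rwa [setLIntegral_univ, measure_univ] at this
  filter_upwards [measure_eq_zero_iff_ae_notMem.1 h1, ae_lt_top hm h2] with x hx1 hx2
  refine ⟨?_, hx2⟩
  simp only [not_le] at hx1
  exact hx1.trans_le (setLIntegral_le_lintegral _ _)

theorem posteriorProb_le_one (n : ℕ) (prior : Measure (ℕ → ℝ)) (θ₀ : ℕ → ℝ) (S : Set (ℕ → ℝ))
    (x : ℕ → ℝ) : posteriorProb n prior θ₀ S x ≤ 1 :=
  ENNReal.div_le_of_le_mul (by rw [one_mul]; exact setLIntegral_le_lintegral _ _)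

/-- Posterior contraction from a prior mass bound, a sieve and a test. -/
theorem lintegral_posteriorProb_le {n : ℕ} (hn : 1 ≤ n) (prior : Measure (ℕ → ℝ))
    [IsProbabilityMeasure prior] (θ₀ : ℕ → ℝ) {R : ℝ} {B : Set (ℕ → ℝ)} (hB : MeasurableSet B)
    (hR : ∀ θ ∈ B, ∀ I : Finset ℕ, ∑ i ∈ I, (θ i - θ₀ i) ^ 2 ≤ R) (hpos : prior B ≠ 0)
    {S G Φ : Set (ℕ → ℝ)} (hS : MeasurableSet S) (hG : MeasurableSet G) (hΦ : MeasurableSet Φ)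
    {δ : ℝ≥0∞} (hδ : ∀ θ ∈ S, θ ∉ G → seqModel n θ Φᶜ ≤ δ) (c : ℝ≥0∞) :
    ∫⁻ x, posteriorProb n prior θ₀ S x ∂(seqModel n θ₀) ≤
      seqModel n θ₀ Φ + ENNReal.ofReal (Real.exp (n * R)) * c / prior B +
        c⁻¹ * (prior G + δ) := by
  set E := {x | ∫⁻ θ in B, likelihoodRatio n θ₀ θ x ∂prior ≤ c} with hEdef
  have hE : MeasurableSet E :=
    measurableSet_le (measurable_setLIntegral_likelihoodRatio n prior θ₀ B) measurable_const
  have hPE : seqModel n θ₀ E ≤ ENNReal.ofReal (Real.exp (n * R)) * c / prior B :=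
    ENNReal.le_div_iff_mul_le (Or.inl hpos) (Or.inl (measure_ne_top _ _)) |>.2
      (measure_evidence_le_mul_le hn prior θ₀ hB hR c)
  have hN : Measurable fun x => ∫⁻ θ in S, likelihoodRatio n θ₀ θ x ∂prior :=
    measurable_setLIntegral_likelihoodRatio n prior θ₀ S
  -- The posterior probability is bounded by 1 where the test rejects or the evidence is small.
  -- Elsewhere the denominator exceeds `c`.
  have hpt : ∀ x, posteriorProb n prior θ₀ S x ≤ Φ.indicator 1 x + E.indicator 1 x +
      Φᶜ.indicator (fun x => c⁻¹ * ∫⁻ θ in S, likelihoodRatio n θ₀ θ x ∂prior) x := by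
    intro x
    by_cases hxΦ : x ∈ Φ
    · refine (posteriorProb_le_one n prior θ₀ S x).trans ?_
      rw [Set.indicator_of_mem hxΦ, add_assoc]
      exact le_self_add
    by_cases hxE : x ∈ E
    · refine (posteriorProb_le_one n prior θ₀ S x).trans ?_
      rw [Set.indicator_of_mem hxE, add_assoc]
      exact le_add_left le_self_add
    · rw [Set.indicator_of_mem (show x ∈ Φᶜ from hxΦ)]
      refine le_add_left ?_
      rw [posteriorProb, ENNReal.div_eq_inv_mul]
      gcongr
      rw [hEdef, Set.mem_ofPred_eq, not_le] at hxE
      exact hxE.le.trans (setLIntegral_le_lintegral _ _)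
  have hnum : ∫⁻ x in Φᶜ, ∫⁻ θ in S, likelihoodRatio n θ₀ θ x ∂prior ∂(seqModel n θ₀) ≤
      prior G + δ := by
    rw [lintegral_lintegral_swap (f := fun x θ => likelihoodRatio n θ₀ θ x)
      ((measurable_likelihoodRatio n θ₀).comp measurable_swap).aemeasurable]
    calc ∫⁻ θ in S, ∫⁻ x in Φᶜ, likelihoodRatio n θ₀ θ x ∂(seqModel n θ₀) ∂prior
        ≤ ∫⁻ θ in S, (G.indicator 1 θ + δ) ∂prior := by
          refine setLIntegral_mono' hS fun θ hθ => ?_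
          refine (setLIntegral_likelihoodRatio_le n θ₀ θ hΦ.compl).trans ?_
          by_cases hθG : θ ∈ G
          · rw [Set.indicator_of_mem hθG]
            exact prob_le_one.trans le_self_add
          · exact (hδ θ hθ hθG).trans le_add_self
      _ ≤ ∫⁻ θ, (G.indicator 1 θ + δ) ∂prior := setLIntegral_le_lintegral _ _
      _ = prior G + δ := by
          rw [lintegral_add_right _ measurable_const, lintegral_indicator_one hG]
          simp
  calc ∫⁻ x, posteriorProb n prior θ₀ S x ∂(seqModel n θ₀)
      ≤ ∫⁻ x, (Φ.indicator 1 x + E.indicator 1 x + Φᶜ.indicator (fun x => c⁻¹ *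
          ∫⁻ θ in S, likelihoodRatio n θ₀ θ x ∂prior) x) ∂(seqModel n θ₀) := lintegral_mono hpt
    _ = seqModel n θ₀ Φ + seqModel n θ₀ E + c⁻¹ *
          ∫⁻ x in Φᶜ, ∫⁻ θ in S, likelihoodRatio n θ₀ θ x ∂prior ∂(seqModel n θ₀) := by
        rw [lintegral_add_left (f := fun x => Φ.indicator 1 x + E.indicator 1 x)
          ((measurable_one.indicator hΦ).add (measurable_one.indicator hE)),
          lintegral_add_left (measurable_one.indicator hΦ), lintegral_indicator_one hΦ,
          lintegral_indicator_one hE, lintegral_indicator hΦ.compl, lintegral_const_mul _ hN]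
    _ ≤ _ := by gcongr

/-! ### Block arithmetic -/

theorem blockStart_le_exp (k : ℕ) : (blockStart k : ℝ) ≤ Real.exp k :=
  Nat.floor_le (Real.exp_nonneg _)

theorem half_exp_le_blockStart (k : ℕ) : Real.exp k / 2 ≤ blockStart k := by
  have h1 : Real.exp k < blockStart k + 1 := Nat.lt_floor_add_one _
  have h2 : (1 : ℝ) ≤ blockStart k := by exact_mod_cast (Nat.zero_le k).trans_lt (lt_blockStart k)
  linarith

theorem one_le_blockStart (k : ℕ) : 1 ≤ blockStart k := (Nat.zero_le k).trans_lt (lt_blockStart k)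

theorem blockStart_blockIndex_le (j : ℕ) : blockStart (blockIndex (j + 1)) ≤ j + 1 :=
  (Finset.mem_Ico.1 ((blockIndex_eq_iff (Nat.le_add_left 1 j) _).1 rfl)).1

theorem lt_blockStart_blockIndex (j : ℕ) : j + 1 < blockStart (blockIndex (j + 1) + 1) :=
  (Finset.mem_Ico.1 ((blockIndex_eq_iff (Nat.le_add_left 1 j) _).1 rfl)).2

theorem exp_blockIndex_le (j : ℕ) : Real.exp (blockIndex (j + 1)) ≤ 2 * ((j : ℝ) + 1) := by
  have h1 := half_exp_le_blockStart (blockIndex (j + 1))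
  have h2 : (blockStart (blockIndex (j + 1)) : ℝ) ≤ (j : ℝ) + 1 := by
    exact_mod_cast blockStart_blockIndex_le j
  linarith

theorem le_exp_blockIndex (j : ℕ) : (j : ℝ) + 1 ≤ Real.exp ((blockIndex (j + 1) : ℝ) + 1) := by
  have h1 := blockStart_le_exp (blockIndex (j + 1) + 1)
  have h2 : (j : ℝ) + 1 ≤ (blockStart (blockIndex (j + 1) + 1) : ℝ) := by
    exact_mod_cast (lt_blockStart_blockIndex j).le
  push_cast at h1
  linarith

/-- The number of coordinates in the first `k` blocks. -/
noncomputable def headSize (k : ℕ) : ℕ := blockStart k - 1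

theorem headSize_add_one (k : ℕ) : headSize k + 1 = blockStart k :=
  Nat.sub_add_cancel (one_le_blockStart k)

theorem headSize_le_exp (k : ℕ) : (headSize k : ℝ) ≤ Real.exp k := by
  have h1 := blockStart_le_exp k
  have h2 : (headSize k : ℝ) + 1 = blockStart k := by exact_mod_cast headSize_add_one k
  linarith

theorem half_exp_le_headSize (k : ℕ) : Real.exp k / 2 ≤ (headSize k : ℝ) + 1 := by
  have h2 : (headSize k : ℝ) + 1 = blockStart k := by exact_mod_cast headSize_add_one k
  rw [h2]
  exact half_exp_le_blockStart k

/-- Coordinate `j` is the entry with index j + 1, so the blocks before B_k occupy exactly the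
coordinates below l_k - 1. The next lemma is the other half. -/
theorem blockIndex_lt_of_lt_headSize {j k : ℕ} (h : j < headSize k) : blockIndex (j + 1) < k := by
  by_contra! hk
  have h1 := blockStart_mono hk
  have h2 := blockStart_blockIndex_le j
  have h3 := headSize_add_one k
  omega

theorem le_blockIndex_of_headSize_le {j k : ℕ} (h : headSize k ≤ j) : k ≤ blockIndex (j + 1) := by
  by_contra! hk
  have h1 := blockStart_mono (Nat.succ_le_of_lt hk)
  have h2 := lt_blockStart_blockIndex j
  have h3 := headSize_add_one k
  simp only [Nat.succ_eq_add_one] at h1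
  omega

/-- The Gaussian tail of the block number decays faster than any power. -/
theorem exists_exp_neg_blockIndex_sq_le {c : ℝ} (hc : 0 < c) {q : ℝ} (hq : 0 ≤ q) :
    ∃ C : ℝ, 0 < C ∧ ∀ j : ℕ,
      Real.exp (-c * (blockIndex (j + 1) : ℝ) ^ 2) ≤ C * ((j : ℝ) + 1) ^ (-q) := by
  -- Completing the square: q(κ + 1) - cκ² is at most q²/(4c) + q.
  refine ⟨Real.exp (q ^ 2 / (4 * c) + q), Real.exp_pos _, fun j => ?_⟩
  have hj : (0 : ℝ) < (j : ℝ) + 1 := by positivity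
  set κ : ℝ := (blockIndex (j + 1) : ℝ)
  have h1 : Real.exp (-(q * (κ + 1))) ≤ ((j : ℝ) + 1) ^ (-q) := by
    have := Real.rpow_le_rpow_of_nonpos hj (le_exp_blockIndex j) (neg_nonpos.2 hq)
    rw [← Real.exp_mul] at this
    refine le_trans (le_of_eq ?_) this
    congr 1
    ring
  refine le_trans ?_ (mul_le_mul_of_nonneg_left h1 (Real.exp_nonneg _))
  rw [← Real.exp_add]
  refine Real.exp_le_exp.2 ?_
  have h2 : 0 ≤ (2 * c * κ - q) ^ 2 / (4 * c) := by positivity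
  have h3 : (2 * c * κ - q) ^ 2 / (4 * c) = c * κ ^ 2 - q * κ + q ^ 2 / (4 * c) := by
    field_simp
    ring
  linarith

/-- Each term splits as (D+1)^{-a} times the summable (j+1)^{-2}. The wasted power is harmless,
since the block decay beats every power. -/
theorem exists_tsum_rpow_tail_le (a : ℝ) (ha : 0 ≤ a) :
    ∃ C : ℝ, 0 < C ∧ ∀ D : ℕ, ∑' j : ℕ, ENNReal.ofReal (((j + D : ℕ) + 1 : ℝ) ^ (-(a + 2))) ≤
      ENNReal.ofReal (C * ((D : ℝ) + 1) ^ (-a)) := by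
  have hs : Summable fun j : ℕ => ((j : ℝ) + 1) ^ (-2 : ℝ) := by
    have := (Real.summable_nat_rpow (p := -2)).2 (by norm_num)
    exact_mod_cast (summable_nat_add_iff 1).2 this
  refine ⟨(∑' j : ℕ, ((j : ℝ) + 1) ^ (-2 : ℝ)) + 1, ?_, fun D => ?_⟩
  · have : 0 ≤ ∑' j : ℕ, ((j : ℝ) + 1) ^ (-2 : ℝ) := tsum_nonneg fun j => by positivity
    linarith
  calc ∑' j : ℕ, ENNReal.ofReal (((j + D : ℕ) + 1 : ℝ) ^ (-(a + 2)))
      ≤ ∑' j : ℕ, ENNReal.ofReal (((D : ℝ) + 1) ^ (-a)) *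
          ENNReal.ofReal (((j : ℝ) + 1) ^ (-2 : ℝ)) := by
        refine ENNReal.tsum_le_tsum fun j => ?_
        rw [← ENNReal.ofReal_mul (by positivity)]
        refine ENNReal.ofReal_le_ofReal ?_
        rw [neg_add, Real.rpow_add (by positivity)]
        push_cast
        have hD : (0 : ℝ) ≤ D := Nat.cast_nonneg D
        have hj : (0 : ℝ) ≤ j := Nat.cast_nonneg j
        refine mul_le_mul ?_ ?_ (by positivity) (by positivity)
        · exact Real.rpow_le_rpow_of_nonpos (by positivity) (by linarith) (by linarith)
        · exact Real.rpow_le_rpow_of_nonpos (by positivity) (by linarith) (by norm_num)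
    _ = ENNReal.ofReal (((D : ℝ) + 1) ^ (-a)) *
          ENNReal.ofReal (∑' j : ℕ, ((j : ℝ) + 1) ^ (-2 : ℝ)) := by
        rw [ENNReal.tsum_mul_left, ENNReal.ofReal_tsum_of_nonneg (fun j => by positivity) hs]
    _ ≤ _ := by
        rw [← ENNReal.ofReal_mul (by positivity), mul_comm]
        refine ENNReal.ofReal_le_ofReal ?_
        gcongr
        linarith

/-! ### Sobolev balls -/

theorem sum_le_of_mem_sobolevBall {α Q : ℝ} {θ : ℕ → ℝ} (hθ : θ ∈ sobolevBall α Q)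
    (I : Finset ℕ) : ∑ j ∈ I, ((j : ℝ) + 1) ^ (2 * α) * θ j ^ 2 ≤ Q ^ 2 := by
  have h := (ENNReal.sum_le_tsum I).trans hθ
  rw [← ENNReal.ofReal_sum_of_nonneg (fun j _ => by positivity)] at h
  exact (ENNReal.ofReal_le_ofReal_iff (sq_nonneg Q)).1 h

theorem tsum_sq_tail_le_of_mem_sobolevBall {α Q : ℝ} (hα : 0 < α) {θ : ℕ → ℝ}
    (hθ : θ ∈ sobolevBall α Q) (D : ℕ) :
    ∑' j : ℕ, ENNReal.ofReal (θ (j + D) ^ 2) ≤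
      ENNReal.ofReal (Q ^ 2 * ((D : ℝ) + 1) ^ (-(2 * α))) := by
  have h1 : ∑' j : ℕ, ENNReal.ofReal (((j + D : ℕ) + 1 : ℝ) ^ (2 * α) * θ (j + D) ^ 2) ≤
      ENNReal.ofReal (Q ^ 2) :=
    le_trans (ENNReal.tsum_comp_le_tsum_of_injective (add_left_injective D)
      (fun j : ℕ => ENNReal.ofReal (((j : ℝ) + 1) ^ (2 * α) * θ j ^ 2))) hθ
  have hD : (0 : ℝ) < (D : ℝ) + 1 := by positivity
  calc ∑' j : ℕ, ENNReal.ofReal (θ (j + D) ^ 2)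
      ≤ ∑' j : ℕ, ENNReal.ofReal (((j + D : ℕ) + 1 : ℝ) ^ (2 * α) * θ (j + D) ^ 2) *
          ENNReal.ofReal (((D : ℝ) + 1) ^ (-(2 * α))) := by
        refine ENNReal.tsum_le_tsum fun j => ?_
        rw [← ENNReal.ofReal_mul (by positivity)]
        refine ENNReal.ofReal_le_ofReal ?_
        rw [Real.rpow_neg hD.le, ← div_eq_mul_inv, le_div_iff₀ (by positivity), mul_comm]
        gcongr
        linarith [Nat.cast_nonneg (α := ℝ) j]
    _ ≤ _ := by
        rw [ENNReal.tsum_mul_right, ENNReal.ofReal_mul (sq_nonneg Q)]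
        gcongr

/-! ### The law of the scales -/

theorem measurable_ofReal_dens (g : MixingDensities) (k : ℕ) :
    Measurable fun t => ENNReal.ofReal (g.dens k t) := (g.measurable_dens k).ennreal_ofReal

theorem scaleLaw_Ioi_zero (g : MixingDensities) (k : ℕ) : g.scaleLaw k (Set.Ioi 0) = 1 := by
  rw [MixingDensities.scaleLaw, withDensity_apply _ measurableSet_Ioi, Measure.restrict_restrict
    measurableSet_Ioi, Set.inter_self, g.lintegral_dens k]

theorem lintegral_scaleLaw (g : MixingDensities) (k : ℕ) :
    ∫⁻ t, ENNReal.ofReal t ∂(g.scaleLaw k) =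
      ∫⁻ t in Set.Ioi 0, ENNReal.ofReal (t * g.dens k t) := by
  rw [MixingDensities.scaleLaw, lintegral_withDensity_eq_lintegral_mul _
    (measurable_ofReal_dens g k) ENNReal.measurable_ofReal]
  refine setLIntegral_congr_fun measurableSet_Ioi fun t ht => ?_
  simp only [Pi.mul_apply]
  rw [mul_comm, ENNReal.ofReal_mul (le_of_lt ht)]

theorem scaleLaw_Ioi_exp_le {g : MixingDensities} {c₃ : ℝ} {k : ℕ}
    (h : ∫⁻ t in Set.Ioi (Real.exp (-(k : ℝ) ^ 2)), ENNReal.ofReal (g.dens k t) ≤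
      ENNReal.ofReal (Real.exp (-c₃ * Real.exp k))) :
    g.scaleLaw k (Set.Ioi (Real.exp (-(k : ℝ) ^ 2))) ≤
      ENNReal.ofReal (Real.exp (-c₃ * Real.exp k)) := by
  rw [MixingDensities.scaleLaw, withDensity_apply _ measurableSet_Ioi, Measure.restrict_restrict
    measurableSet_Ioi, Set.inter_eq_left.2 (Set.Ioi_subset_Ioi (Real.exp_nonneg _))]
  exact h

/-- For k ≥ β + 1 the window lies in [e^{-k²}, e^{-k}], where the density bound applies. Its length
is at least e^{-βk-1}, which is absorbed by e^{-(β+1)e^k}. -/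
theorem scaleLaw_Icc_ge_of_lower {g : MixingDensities} {c₁ β : ℝ} (hβ : 1 ≤ β)
    {k : ℕ} (hk : β + 1 ≤ k) (h : ∀ t ∈ Set.Icc (Real.exp (-(k : ℝ) ^ 2)) (Real.exp (-(k : ℝ))),
      Real.exp (-c₁ * Real.exp k) ≤ g.dens k t) :
    ENNReal.ofReal (Real.exp (-((β + 1 + c₁) * Real.exp k))) ≤
      g.scaleLaw k (Set.Icc (Real.exp (-(β * k) - 1)) (Real.exp (-(β * k)))) := by
  have hk0 : (0 : ℝ) ≤ k := Nat.cast_nonneg k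
  have hk1 : (1 : ℝ) ≤ k := by linarith
  have hsub : Set.Icc (Real.exp (-(β * k) - 1)) (Real.exp (-(β * k))) ⊆ Set.Ioi 0 :=
    fun t ht => (Real.exp_pos _).trans_le ht.1
  rw [MixingDensities.scaleLaw, withDensity_apply _ measurableSet_Icc, Measure.restrict_restrict
    measurableSet_Icc, Set.inter_eq_left.2 hsub]
  calc ENNReal.ofReal (Real.exp (-((β + 1 + c₁) * Real.exp k)))
      ≤ ENNReal.ofReal (Real.exp (-c₁ * Real.exp k)) *
          volume (Set.Icc (Real.exp (-(β * k) - 1)) (Real.exp (-(β * k)))) := by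
        rw [Real.volume_Icc, ← ENNReal.ofReal_mul (Real.exp_nonneg _)]
        refine ENNReal.ofReal_le_ofReal ?_
        have h1 : Real.exp (-(β * k) - 1) ≤ Real.exp (-(β * k)) - Real.exp (-(β * k) - 1) := by
          have h2 : Real.exp (-(β * k)) = Real.exp (-(β * k) - 1) * Real.exp 1 := by
            rw [← Real.exp_add]; ring_nf
          have h3 : (2 : ℝ) ≤ Real.exp 1 := by linarith [Real.add_one_le_exp (1 : ℝ)]
          rw [h2]
          nlinarith [Real.exp_pos (-(β * k) - 1)]
        refine le_trans ?_ (mul_le_mul_of_nonneg_left h1 (Real.exp_nonneg _))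
        rw [← Real.exp_add]
        refine Real.exp_le_exp.2 ?_
        nlinarith [Real.add_one_le_exp (k : ℝ)]
    _ = ∫⁻ _ in Set.Icc (Real.exp (-(β * k) - 1)) (Real.exp (-(β * k))),
          ENNReal.ofReal (Real.exp (-c₁ * Real.exp k)) := by rw [setLIntegral_const]
    _ ≤ _ := by
        refine setLIntegral_mono (measurable_ofReal_dens g k) fun t ht => ?_
        refine ENNReal.ofReal_le_ofReal (h t ⟨le_trans (Real.exp_le_exp.2 ?_) ht.1,
          ht.2.trans (Real.exp_le_exp.2 ?_)⟩)
        · nlinarith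
        · nlinarith

/-- Covers the finitely many small `k` that the density bound misses: the windows exhaust the half
line, so one of them has mass above e^{-1}. -/
theorem exists_scaleLaw_Icc_ge (g : MixingDensities) (β : ℝ) (k : ℕ) :
    ∃ K₀ : ℝ, 1 ≤ K₀ ∧ ∀ K ≥ K₀, ENNReal.ofReal (Real.exp (-(K * Real.exp k))) ≤
      g.scaleLaw k (Set.Icc (K⁻¹ * Real.exp (-(β * k))) (K * Real.exp (-(β * k)))) := by
  have hexp : 0 < Real.exp (-(β * k)) := Real.exp_pos _
  set S : ℕ → Set ℝ := fun i =>
    Set.Icc (((i : ℝ) + 1)⁻¹ * Real.exp (-(β * k))) (((i : ℝ) + 1) * Real.exp (-(β * k))) with hS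
  have hmono : Monotone S := by
    intro a b hab
    have : (a : ℝ) ≤ b := by exact_mod_cast hab
    refine Set.Icc_subset_Icc ?_ ?_ <;> gcongr
  have hU : Set.Ioi 0 ⊆ ⋃ i, S i := by
    intro t ht
    have ht0 : 0 < t := ht
    obtain ⟨i, hi⟩ := exists_nat_ge (max (Real.exp (-(β * k)) / t) (t / Real.exp (-(β * k))))
    refine Set.mem_iUnion.2 ⟨i, ?_, ?_⟩
    · rw [inv_mul_le_iff₀ (by positivity), ← div_le_iff₀ ht0]
      exact (le_max_left _ _).trans (hi.trans (by linarith))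
    · rw [← div_le_iff₀ hexp]
      exact (le_max_right _ _).trans (hi.trans (by linarith))
  have h1 : Tendsto (fun i => g.scaleLaw k (S i)) atTop (𝓝 1) := by
    have := tendsto_measure_iUnion_atTop (μ := g.scaleLaw k) hmono
    rwa [show g.scaleLaw k (⋃ i, S i) = 1 from le_antisymm prob_le_one
      (by rw [← scaleLaw_Ioi_zero g k]; exact measure_mono hU)] at this
  have hlt : ENNReal.ofReal (Real.exp (-1)) < 1 := by
    rw [ENNReal.ofReal_lt_one]
    simp
  obtain ⟨i, hi⟩ := (h1.eventually (lt_mem_nhds hlt)).exists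
  refine ⟨(i : ℝ) + 1, by linarith [Nat.cast_nonneg (α := ℝ) i], fun K hK => ?_⟩
  have hi0 : (0 : ℝ) < (i : ℝ) + 1 := by positivity
  have hK1 : 1 ≤ K := le_trans (by linarith [Nat.cast_nonneg (α := ℝ) i]) hK
  refine le_trans ?_ (hi.le.trans (measure_mono (Set.Icc_subset_Icc ?_ ?_)))
  · refine ENNReal.ofReal_le_ofReal (Real.exp_le_exp.2 ?_)
    have : (1 : ℝ) ≤ Real.exp k := Real.one_le_exp (Nat.cast_nonneg k)
    nlinarith
  · gcongr
  · gcongr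

/-- A multiplicative window around `e^{-βk}` carries the mass `e^{-K e^k}` of `A_k`. -/
theorem exists_forall_scaleLaw_Icc_ge {g : MixingDensities} (hg : InMixingClass g) {β : ℝ}
    (hβ : 1 ≤ β) : ∃ K : ℝ, 1 ≤ K ∧ ∀ k : ℕ, ENNReal.ofReal (Real.exp (-(K * Real.exp k))) ≤
      g.scaleLaw k (Set.Icc (K⁻¹ * Real.exp (-(β * k))) (K * Real.exp (-(β * k)))) := by
  obtain ⟨c₁, hc₁, hlow⟩ := hg.lower
  choose K₀ hK₀ hK₀' using exists_scaleLaw_Icc_ge g β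
  set k₀ := ⌈β + 1⌉₊
  -- The sum dominates every `K₀ k` with `k < k₀`. The term `Real.exp 1` makes K⁻¹ ≤ e^{-1}, so the
  -- window contains the one used for large `k`.
  set K : ℝ := max (β + 1 + c₁ + Real.exp 1) (∑ k ∈ Finset.range k₀, K₀ k) with hKdef
  have hK1 : β + 1 + c₁ + Real.exp 1 ≤ K := le_max_left _ _
  have he : 0 < Real.exp 1 := Real.exp_pos _
  refine ⟨K, by linarith, fun k => ?_⟩
  by_cases hk : k < k₀
  · refine hK₀' k K (le_trans ?_ (le_max_right _ _))
    exact Finset.single_le_sum (f := K₀) (fun i _ => zero_le_one.trans (hK₀ i))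
      (Finset.mem_range.2 hk)
  · have hk' : β + 1 ≤ k := (Nat.le_ceil _).trans (by exact_mod_cast not_lt.1 hk)
    refine le_trans ?_ ((scaleLaw_Icc_ge_of_lower hβ hk' (hlow k)).trans
      (measure_mono (Set.Icc_subset_Icc ?_ ?_)))
    · refine ENNReal.ofReal_le_ofReal (Real.exp_le_exp.2 ?_)
      have := Real.exp_pos (k : ℝ)
      nlinarith
    · rw [sub_eq_neg_add, Real.exp_add, Real.exp_neg 1]
      have : Real.exp 1 ≤ K := by linarith
      gcongr
    · refine le_mul_of_one_le_left (Real.exp_nonneg _) (by linarith)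

/-! ### Prior mass of neighbourhoods -/

theorem rpow_headSize_le {a r : ℝ} (ha : 0 ≤ a) (hr : 0 < r) {k : ℕ}
    (hk : r ≤ Real.exp ((k : ℝ) + 1)) :
    ((headSize k : ℝ) + 1) ^ (-a) ≤ (2 * Real.exp 1) ^ a * r ^ (-a) := by
  have he : 0 < 2 * Real.exp 1 := by positivity
  have h1 : r / (2 * Real.exp 1) ≤ (headSize k : ℝ) + 1 := by
    refine le_trans ?_ (half_exp_le_headSize k)
    rw [Real.exp_add] at hk
    rw [div_le_div_iff₀ he (by norm_num)]
    nlinarith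
  refine (Real.rpow_le_rpow_of_nonpos (by positivity) h1 (neg_nonpos.2 ha)).trans (le_of_eq ?_)
  rw [Real.div_rpow hr.le he.le, Real.rpow_neg he.le, div_inv_eq_mul, mul_comm]

theorem exists_tsum_exp_neg_blockIndex_sq_tail_le {c : ℝ} (hc : 0 < c) {a : ℝ} (ha : 0 ≤ a) :
    ∃ C : ℝ, 0 < C ∧ ∀ (k : ℕ) (r : ℝ), 0 < r → r ≤ Real.exp ((k : ℝ) + 1) →
      ∑' j : ℕ, ENNReal.ofReal
        (Real.exp (-c * (blockIndex (j + headSize k + 1) : ℝ) ^ 2)) ≤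
      ENNReal.ofReal (C * r ^ (-a)) := by
  obtain ⟨C₁, hC₁, h₁⟩ := exists_exp_neg_blockIndex_sq_le hc (q := a + 2) (by linarith)
  obtain ⟨C₂, hC₂, h₂⟩ := exists_tsum_rpow_tail_le a ha
  refine ⟨C₁ * (C₂ * (2 * Real.exp 1) ^ a), by positivity, fun k r hr hk => ?_⟩
  calc _ ≤ ∑' j : ℕ, ENNReal.ofReal C₁ *
        ENNReal.ofReal (((j + headSize k : ℕ) + 1 : ℝ) ^ (-(a + 2))) := by
        refine ENNReal.tsum_le_tsum fun j => ?_
        rw [← ENNReal.ofReal_mul hC₁.le]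
        exact ENNReal.ofReal_le_ofReal (by exact_mod_cast h₁ (j + headSize k))
    _ ≤ ENNReal.ofReal C₁ * ENNReal.ofReal (C₂ * ((headSize k : ℝ) + 1) ^ (-a)) := by
        rw [ENNReal.tsum_mul_left]
        gcongr
        exact h₂ _
    _ ≤ _ := by
        rw [← ENNReal.ofReal_mul hC₁.le, mul_assoc C₁, mul_assoc C₂]
        gcongr
        exact rpow_headSize_le ha hr hk

/-- Independence of a coordinate from a box in other coordinates. It serves for the entries of θ
given the scales and again for the scales. -/
theorem setLIntegral_pi_eval {μ : ℕ → Measure ℝ} [∀ i, IsProbabilityMeasure (μ i)]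
    (s : Finset ℕ) {t : ℕ → Set ℝ} (ht : ∀ i, MeasurableSet (t i)) {i : ℕ} (hi : i ∉ s)
    {f : ℝ → ℝ≥0∞} (hf : Measurable f) :
    ∫⁻ x in (s : Set ℕ).pi t, f (x i) ∂(Measure.infinitePi μ) =
      Measure.infinitePi μ ((s : Set ℕ).pi t) * ∫⁻ y, f y ∂(μ i) := by
  classical
  have hmeas : MeasurableSet ((s : Set ℕ).pi t) :=
    MeasurableSet.pi s.countable_toSet fun i _ => ht i
  let F : ℕ → ℝ → ℝ≥0∞ := fun j => if j = i then f else (t j).indicator 1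
  have hF : ∀ j, Measurable (F j) := by
    intro j
    by_cases h : j = i
    · simpa [F, h] using hf
    · simpa [F, h] using measurable_one.indicator (ht j)
  have hne : ∀ j ∈ s, j ≠ i := fun j hj h => hi (h ▸ hj)
  have h1 : ∀ x : ℕ → ℝ, ((s : Set ℕ).pi t).indicator (fun x => f (x i)) x =
      ∏ j ∈ insert i s, F j (x j) := by
    intro x
    rw [Finset.prod_insert hi]
    by_cases hx : x ∈ (s : Set ℕ).pi t
    · rw [Set.indicator_of_mem hx, Finset.prod_eq_one (s := s), mul_one]
      · simp [F]
      · intro j hj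
        simp [F, hne j hj, hx j hj]
    · rw [Set.indicator_of_notMem hx]
      simp only [Set.mem_pi, not_forall] at hx
      obtain ⟨j, hj, hxj⟩ := hx
      rw [Finset.prod_eq_zero (i := j) hj, mul_zero]
      simp [F, hne j hj, hxj]
  rw [← lintegral_indicator hmeas, lintegral_congr h1, lintegral_prod_infinitePi _ hF,
    Finset.prod_insert hi, mul_comm, Measure.infinitePi_pi _ (fun i _ => ht i)]
  congr 1
  · refine Finset.prod_congr rfl fun j hj => ?_
    simp only [F, hne j hj, if_false]
    exact lintegral_indicator_one (ht j)
  · simp [F]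

theorem measurable_tsum_sq_tail (D : ℕ) :
    Measurable fun θ : ℕ → ℝ => ∑' j : ℕ, ENNReal.ofReal (θ (j + D) ^ 2) :=
  Measurable.tsum fun j => by fun_prop

/-- A box for the first coordinates together with a small tail. -/
theorem infinitePi_pi_inter_tail_ge (v : ℕ → ℝ≥0) (D : ℕ) {t : ℕ → Set ℝ}
    (ht : ∀ i, MeasurableSet (t i)) (τ : ℝ≥0∞) :
    Measure.infinitePi (fun j => gaussianReal 0 (v j)) ((Finset.range D : Set ℕ).pi t) *
        (1 - (∑' j, (v (j + D) : ℝ≥0∞)) / τ) ≤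
      Measure.infinitePi (fun j => gaussianReal 0 (v j))
        ((Finset.range D : Set ℕ).pi t ∩ {θ | ∑' j, ENNReal.ofReal (θ (j + D) ^ 2) ≤ τ}) := by
  set P := Measure.infinitePi (fun j => gaussianReal 0 (v j))
  set H := (Finset.range D : Set ℕ).pi t
  set T := {θ : ℕ → ℝ | ∑' j, ENNReal.ofReal (θ (j + D) ^ 2) ≤ τ} with hT
  have hH : MeasurableSet H := MeasurableSet.pi (Finset.range D).countable_toSet fun i _ => ht i
  have hint : ∫⁻ θ in H, ∑' j, ENNReal.ofReal (θ (j + D) ^ 2) ∂P =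
      P H * ∑' j, (v (j + D) : ℝ≥0∞) := by
    rw [lintegral_tsum fun j => Measurable.aemeasurable (by fun_prop), ← ENNReal.tsum_mul_left]
    refine tsum_congr fun j => ?_
    rw [setLIntegral_pi_eval (Finset.range D) ht (i := j + D) (by simp)
      (f := fun y => ENNReal.ofReal (y ^ 2)) (by fun_prop), lintegral_sq_gaussianReal]
  rw [ENNReal.mul_sub fun _ _ => measure_ne_top _ _, mul_one, tsub_le_iff_right]
  -- Markov's inequality on the box; the degenerate thresholds 0 and ∞ are treated apart.
  have h1 : P (H ∩ Tᶜ) ≤ P H * ((∑' j, (v (j + D) : ℝ≥0∞)) / τ) := by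
    rw [← mul_div_assoc, ← hint]
    rcases eq_or_ne τ 0 with h0 | h0
    · by_cases hz : ∫⁻ θ in H, ∑' j, ENNReal.ofReal (θ (j + D) ^ 2) ∂P = 0
      · rw [setLIntegral_eq_zero_iff hH (measurable_tsum_sq_tail D)] at hz
        refine (le_of_eq ?_).trans zero_le
        refine measure_mono_null ?_ hz
        rintro θ ⟨h1, h2⟩ h3
        exact h2 (by rw [hT, Set.mem_ofPred_eq, h3 h1]; exact zero_le)
      · rw [h0, ENNReal.div_zero hz]
        exact le_top
    rcases eq_or_ne τ ∞ with ht' | ht'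
    · simp [hT, ht']
    rw [ENNReal.le_div_iff_mul_le (Or.inl h0) (Or.inl ht'), mul_comm]
    calc τ * P (H ∩ Tᶜ) ≤ τ * (P.restrict H) {θ | τ ≤ ∑' j, ENNReal.ofReal (θ (j + D) ^ 2)} := by
          rw [Measure.restrict_apply (measurableSet_le measurable_const
            (measurable_tsum_sq_tail D)), Set.inter_comm]
          gcongr
          intro θ hθ
          rw [Set.mem_compl_iff, hT, Set.mem_ofPred_eq, not_le] at hθ
          exact hθ.le
      _ ≤ _ := mul_meas_ge_le_lintegral (measurable_tsum_sq_tail D) τ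
  calc P H ≤ P (H ∩ T) + P (H ∩ Tᶜ) := by
        rw [← Set.sdiff_eq]
        exact measure_le_inter_add_sdiff _ _ _
    _ ≤ _ := by gcongr

/-- In the window, A is comparable to (j+1)^{-β}, because e^k is comparable to j + 1 on block k.
Hence η/√A is at least of order ((j+1)/r)^{β/2} for η = r^{-β/2}, and η²/A stays bounded since j + 1
≤ r. -/
theorem gaussianReal_window_ge {K β r : ℝ} (hK : 1 ≤ K) (hβ : 1 ≤ β) (hr : 1 ≤ r) {j : ℕ}
    (hj : (j : ℝ) + 1 ≤ r) (t : ℝ) {A : ℝ}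
    (hA : A ∈ Set.Icc (K⁻¹ * Real.exp (-(β * blockIndex (j + 1))))
      (K * Real.exp (-(β * blockIndex (j + 1))))) :
    ENNReal.ofReal ((2 * √(K * Real.exp β))⁻¹ * (((j : ℝ) + 1) / r) ^ (β / 2) *
      Real.exp (-(K * 2 ^ β * (((j : ℝ) + 1) ^ β * t ^ 2 + 1)))) ≤
    gaussianReal 0 (Real.toNNReal A) (Set.Icc (t - r ^ (-(β / 2))) (t + r ^ (-(β / 2)))) := by
  have hj0 : (0 : ℝ) < (j : ℝ) + 1 := by positivity
  have hr0 : 0 < r := by linarith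
  have hK0 : 0 < K := by linarith
  set κ : ℝ := (blockIndex (j + 1) : ℝ)
  have hA0 : 0 < A := lt_of_lt_of_le (by positivity) hA.1
  have hv : Real.toNNReal A ≠ 0 := by simpa using hA0
  refine le_trans (ENNReal.ofReal_le_ofReal ?_) (gaussianReal_Icc_ge hv t (r ^ (-(β / 2))))
  rw [Real.coe_toNNReal A hA0.le]
  have hη2 : (r ^ (-(β / 2))) ^ 2 = (r ^ β)⁻¹ := by
    rw [← Real.rpow_natCast, ← Real.rpow_mul hr0.le, ← Real.rpow_neg hr0.le]
    congr 1
    push_cast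
    ring
  have hjβ : 0 < ((j : ℝ) + 1) ^ β := by positivity
  refine mul_le_mul ?_ ?_ (Real.exp_nonneg _) (by positivity)
  · have h1 : Real.exp (-(β * κ)) ≤ Real.exp β * (((j : ℝ) + 1) ^ β)⁻¹ := by
      have h2 : ((j : ℝ) + 1) ^ β ≤ Real.exp (β * κ) * Real.exp β := by
        refine (Real.rpow_le_rpow hj0.le (le_exp_blockIndex j) (by linarith)).trans (le_of_eq ?_)
        rw [← Real.exp_mul, ← Real.exp_add]
        congr 1
        ring
      rw [Real.exp_neg, ← div_eq_mul_inv, le_div_iff₀ hjβ, inv_mul_le_iff₀ (Real.exp_pos _)]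
      exact h2
    have h3 : √A ≤ √(K * Real.exp β) * (((j : ℝ) + 1) ^ (β / 2))⁻¹ := by
      refine Real.sqrt_le_iff.2 ⟨by positivity, ?_⟩
      rw [mul_pow, Real.sq_sqrt (by positivity), inv_pow, ← Real.rpow_natCast,
        ← Real.rpow_mul hj0.le]
      refine hA.2.trans ?_
      rw [mul_assoc, show β / 2 * ((2 : ℕ) : ℝ) = β by push_cast; ring]
      gcongr
    rw [Real.div_rpow hj0.le hr0.le, Real.rpow_neg hr0.le]
    have hs : 0 < √A := Real.sqrt_pos.2 hA0
    rw [le_div_iff₀ (by positivity)]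
    calc _ ≤ (2 * √(K * Real.exp β))⁻¹ * (((j : ℝ) + 1) ^ (β / 2) / r ^ (β / 2)) *
          (2 * (√(K * Real.exp β) * (((j : ℝ) + 1) ^ (β / 2))⁻¹)) := by gcongr
      _ = _ := by
        have : √(K * Real.exp β) ≠ 0 := (Real.sqrt_pos.2 (by positivity)).ne'
        have : ((j : ℝ) + 1) ^ (β / 2) ≠ 0 := by positivity
        field_simp
  · refine Real.exp_le_exp.2 (neg_le_neg ?_)
    rw [hη2, div_le_iff₀ hA0]
    have h1 : Real.exp (β * κ) ≤ 2 ^ β * ((j : ℝ) + 1) ^ β := by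
      rw [← Real.mul_rpow (by norm_num) hj0.le, mul_comm β, Real.exp_mul]
      exact Real.rpow_le_rpow (Real.exp_nonneg _) (exp_blockIndex_le j) (by linarith)
    have h2 : 1 ≤ K * 2 ^ β * ((j : ℝ) + 1) ^ β * A := by
      calc (1 : ℝ) = K * (Real.exp (β * κ)) * (K⁻¹ * Real.exp (-(β * κ))) := by
            rw [Real.exp_neg]
            field_simp
        _ ≤ K * (2 ^ β * ((j : ℝ) + 1) ^ β) * A := by
            gcongr
            exact hA.1
        _ = _ := by ring
    have h3 : ((j : ℝ) + 1) ^ β * (r ^ β)⁻¹ ≤ 1 := by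
      rw [← div_eq_mul_inv, div_le_one (by positivity)]
      exact Real.rpow_le_rpow hj0.le hj (by linarith)
    calc t ^ 2 + (r ^ β)⁻¹ ≤ (t ^ 2 + (r ^ β)⁻¹) * (K * 2 ^ β * ((j : ℝ) + 1) ^ β * A) :=
          le_mul_of_one_le_right (by positivity) h2
      _ = K * 2 ^ β * (((j : ℝ) + 1) ^ β * t ^ 2 + ((j : ℝ) + 1) ^ β * (r ^ β)⁻¹) * A := by ring
      _ ≤ _ := by gcongr

/-- The product of the ratios (j+1)/r is D!/r^D ≥ e^{-r}, from one term of the exponential series.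
No logarithm is lost. The Sobolev condition gives ∑(j+1)^{2α+1}θ_j² ≤ rQ² over j < D ≤ r. -/
theorem exp_neg_le_prod_window {K α Q L : ℝ} (hK : 0 ≤ K) (hα : 0 < α) (hL : 1 ≤ L) {r : ℝ}
    (hr : 1 ≤ r) {D : ℕ} (hD : (D : ℝ) ≤ r) {θ : ℕ → ℝ} (hθ : θ ∈ sobolevBall α Q) :
    Real.exp (-((L + (2 * α + 1) / 2 + K * (Q ^ 2 + 1)) * r)) ≤
      ∏ j ∈ Finset.range D, (L⁻¹ * (((j : ℝ) + 1) / r) ^ ((2 * α + 1) / 2) *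
        Real.exp (-(K * (((j : ℝ) + 1) ^ (2 * α + 1) * θ j ^ 2 + 1)))) := by
  have hr0 : 0 < r := by linarith
  rw [Finset.prod_mul_distrib, Finset.prod_mul_distrib, ← Real.exp_sum, Finset.prod_const,
    Finset.card_range, Real.finsetProd_rpow _ _ (fun j _ => by positivity),
    Finset.prod_div_distrib, Finset.prod_const, Finset.card_range]
  have h1 : Real.exp (-(L * r)) ≤ L⁻¹ ^ D := by
    have h2 : L ^ D ≤ Real.exp (L * r) := by
      calc L ^ D ≤ (Real.exp L) ^ D := by
            gcongr
            linarith [Real.add_one_le_exp L]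
        _ = Real.exp (L * D) := by rw [← Real.exp_nat_mul, mul_comm]
        _ ≤ _ := by gcongr
    rw [Real.exp_neg, inv_pow]
    gcongr
  have h2 : Real.exp (-((2 * α + 1) / 2 * r)) ≤
      ((∏ j ∈ Finset.range D, ((j : ℝ) + 1)) / r ^ D) ^ ((2 * α + 1) / 2) := by
    have h3 : (∏ j ∈ Finset.range D, ((j : ℝ) + 1)) = (D.factorial : ℝ) := by
      rw [← Finset.prod_range_add_one_eq_factorial]
      push_cast
      rfl
    have h4 := Real.pow_div_factorial_le_exp r hr0.le D
    have h5 : Real.exp (-r) ≤ (D.factorial : ℝ) / r ^ D := by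
      rw [Real.exp_neg, ← inv_div]
      gcongr
    rw [h3]
    calc Real.exp (-((2 * α + 1) / 2 * r)) = (Real.exp (-r)) ^ ((2 * α + 1) / 2) := by
          rw [← Real.exp_mul]
          congr 1
          ring
      _ ≤ _ := by gcongr
  have h3 : Real.exp (-(K * (Q ^ 2 + 1) * r)) ≤ Real.exp (∑ j ∈ Finset.range D,
      -(K * (((j : ℝ) + 1) ^ (2 * α + 1) * θ j ^ 2 + 1))) := by
    refine Real.exp_le_exp.2 ?_
    rw [Finset.sum_neg_distrib, neg_le_neg_iff, ← Finset.mul_sum, Finset.sum_add_distrib, mul_assoc]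
    refine mul_le_mul_of_nonneg_left ?_ hK
    have h4 : ∑ j ∈ Finset.range D, ((j : ℝ) + 1) ^ (2 * α + 1) * θ j ^ 2 ≤ r * Q ^ 2 := by
      calc _ ≤ ∑ j ∈ Finset.range D, r * (((j : ℝ) + 1) ^ (2 * α) * θ j ^ 2) := by
            refine Finset.sum_le_sum fun j hj => ?_
            have hj' : (j : ℝ) + 1 ≤ D := by exact_mod_cast Finset.mem_range.1 hj
            rw [Real.rpow_add_one (by positivity), mul_comm _ ((j : ℝ) + 1), mul_assoc]
            gcongr
            linarith
        _ ≤ _ := by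
            rw [← Finset.mul_sum]
            gcongr
            exact sum_le_of_mem_sobolevBall hθ _
    simp only [Finset.sum_const, Finset.card_range, nsmul_eq_mul, mul_one]
    nlinarith
  calc _ = Real.exp (-(L * r)) * Real.exp (-((2 * α + 1) / 2 * r)) *
        Real.exp (-(K * (Q ^ 2 + 1) * r)) := by
        rw [← Real.exp_add, ← Real.exp_add]
        congr 1
        ring
    _ ≤ _ := by gcongr

theorem sum_range_exp_le (J : ℕ) : ∑ k ∈ Finset.range J, Real.exp k ≤ Real.exp J := by
  induction J with
  | zero => simp
  | succ J ih =>
    rw [Finset.sum_range_succ]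
    push_cast
    rw [Real.exp_add]
    nlinarith [Real.add_one_le_exp (1 : ℝ), Real.exp_pos (J : ℝ)]

theorem blockPrior_apply (g : MixingDensities) {S : Set (ℕ → ℝ)} (hS : MeasurableSet S) :
    blockPrior g S = ∫⁻ A, blockGaussian A S ∂(Measure.infinitePi g.scaleLaw) :=
  Measure.bind_apply hS blockGaussian.measurable.aemeasurable

instance (g : MixingDensities) : IsProbabilityMeasure (blockPrior g) :=
  ⟨by rw [blockPrior_apply g .univ]; simp⟩

theorem tsum_sq_sub_le (θ θ₀ : ℕ → ℝ) (D : ℕ) :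
    ∑' j, ENNReal.ofReal ((θ (j + D) - θ₀ (j + D)) ^ 2) ≤
      2 * ∑' j, ENNReal.ofReal (θ (j + D) ^ 2) + 2 * ∑' j, ENNReal.ofReal (θ₀ (j + D) ^ 2) := by
  rw [← ENNReal.tsum_mul_left, ← ENNReal.tsum_mul_left, ← ENNReal.tsum_add]
  refine ENNReal.tsum_le_tsum fun j => ?_
  rw [show (2 : ℝ≥0∞) = ENNReal.ofReal 2 by simp, ← ENNReal.ofReal_mul (by norm_num),
    ← ENNReal.ofReal_mul (by norm_num), ← ENNReal.ofReal_add (by positivity) (by positivity)]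
  exact ENNReal.ofReal_le_ofReal (by nlinarith [sq_nonneg (θ (j + D) + θ₀ (j + D))])

theorem tsum_ofReal_eq_sum_add (f : ℕ → ℝ) (hf : ∀ j, 0 ≤ f j) (D : ℕ) :
    ∑' j, ENNReal.ofReal (f j) =
      ENNReal.ofReal (∑ j ∈ Finset.range D, f j) + ∑' j, ENNReal.ofReal (f (j + D)) := by
  rw [ENNReal.ofReal_sum_of_nonneg fun j _ => hf j]
  exact (ENNReal.summable.sum_add_tsum_nat_add' (f := fun j => ENNReal.ofReal (f j)) (k := D)).symm

theorem measurable_tsum_sq_sub (θ₀ : ℕ → ℝ) :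
    Measurable fun θ : ℕ → ℝ => ∑' j, ENNReal.ofReal ((θ j - θ₀ j) ^ 2) :=
  Measurable.tsum fun j => by fun_prop

/-- The prior charges `ℓ²` neighbourhoods of the points of a Sobolev ball: with `r = n ε_n²`, the
mass of a ball of squared radius of order `r^{-2α}` is at least `e^{-Cr}`. -/
theorem exists_blockPrior_nhd_ge {g : MixingDensities} (hg : InMixingClass g) {α Q : ℝ}
    (hα : 0 < α) : ∃ R : ℝ, 0 < R ∧ ∃ C : ℝ, 0 < C ∧ ∀ r : ℝ, 1 ≤ r → ∀ θ₀ ∈ sobolevBall α Q,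
      ENNReal.ofReal (Real.exp (-(C * r))) ≤ blockPrior g
        {θ | ∑' j, ENNReal.ofReal ((θ j - θ₀ j) ^ 2) ≤ ENNReal.ofReal (R * r ^ (-(2 * α)))} := by
  obtain ⟨c₂, hc₂, hmean⟩ := hg.mean
  have hβ : 1 ≤ 2 * α + 1 := by linarith
  obtain ⟨K, hK, hwin⟩ := exists_forall_scaleLaw_Icc_ge hg hβ
  obtain ⟨C₁, hC₁, htail⟩ :=
    exists_tsum_exp_neg_blockIndex_sq_tail_le hc₂ (a := 2 * α) (by linarith)
  set L : ℝ := 2 * √(K * Real.exp (2 * α + 1)) with hL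
  have hL1 : 1 ≤ L := by
    have : 1 ≤ √(K * Real.exp (2 * α + 1)) := by
      rw [Real.one_le_sqrt]
      have := Real.one_le_exp (x := 2 * α + 1) (by linarith)
      nlinarith
    linarith
  set K₂ : ℝ := K * 2 ^ (2 * α + 1) with hK₂
  have hK₂0 : 0 ≤ K₂ := by positivity
  set C₃ : ℝ := L + (2 * α + 1) / 2 + K₂ * (Q ^ 2 + 1) with hC₃
  have hC₃0 : 0 < C₃ := by positivity
  -- The expected tail is at most 4C₁r^{-2α}, half the threshold τ, so Markov's inequality keeps
  -- half of the mass.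
  set T : ℝ := 8 * C₁ with hT
  -- Radius: 1 from the head, the rest from the tails of θ and θ₀. Exponent: `C₃` for the Gaussian
  -- windows, `K` for the scales, 1 for the factor 1/2 ≥ e^{-r}.
  refine ⟨1 + 2 * T + 2 * (Q ^ 2 * (2 * Real.exp 1) ^ (2 * α)), by positivity, C₃ + K + 1,
    by positivity, fun r hr θ₀ hθ₀ => ?_⟩
  have hr0 : 0 < r := by linarith
  set J := ⌊Real.log r⌋₊ with hJ
  have hJ1 : Real.exp J ≤ r := by
    rw [← Real.le_log_iff_exp_le hr0]
    exact Nat.floor_le (Real.log_nonneg hr)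
  have hJ2 : r ≤ Real.exp ((J : ℝ) + 1) := by
    rw [← Real.log_le_iff_le_exp hr0]
    exact (Nat.lt_floor_add_one _).le
  set D := headSize J with hD
  have hDr : (D : ℝ) ≤ r := (headSize_le_exp J).trans hJ1
  set η : ℝ := r ^ (-((2 * α + 1) / 2)) with hη
  set I : ℕ → Set ℝ := fun k =>
    Set.Icc (K⁻¹ * Real.exp (-((2 * α + 1) * k))) (K * Real.exp (-((2 * α + 1) * k))) with hI
  set t : ℕ → Set ℝ := fun j => Set.Icc (θ₀ j - η) (θ₀ j + η) with ht
  set τ : ℝ≥0∞ := ENNReal.ofReal (T * r ^ (-(2 * α))) with hτ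
  set B := {θ : ℕ → ℝ | ∑' j, ENNReal.ofReal ((θ j - θ₀ j) ^ 2) ≤ ENNReal.ofReal
    ((1 + 2 * T + 2 * (Q ^ 2 * (2 * Real.exp 1) ^ (2 * α))) * r ^ (-(2 * α)))} with hB
  have hBm : MeasurableSet B := measurableSet_le (measurable_tsum_sq_sub θ₀) measurable_const
  have hsub : (Finset.range D : Set ℕ).pi t ∩ {θ | ∑' j, ENNReal.ofReal (θ (j + D) ^ 2) ≤ τ} ⊆
      B := by
    rintro θ ⟨h1, h2⟩
    have h2' : ∑' j, ENNReal.ofReal (θ (j + D) ^ 2) ≤ τ := h2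
    have h3 : ∑ j ∈ Finset.range D, (θ j - θ₀ j) ^ 2 ≤ r ^ (-(2 * α)) := by
      calc _ ≤ ∑ j ∈ Finset.range D, η ^ 2 := by
            refine Finset.sum_le_sum fun j hj => ?_
            have := h1 j hj
            exact sq_le_sq' (by linarith [this.1]) (by linarith [this.2])
        _ = D * η ^ 2 := by simp
        _ ≤ r * η ^ 2 := by gcongr
        _ = r ^ (-(2 * α)) := by
            rw [hη, ← Real.rpow_natCast, ← Real.rpow_mul hr0.le]
            nth_rewrite 1 [← Real.rpow_one r]
            rw [← Real.rpow_add hr0]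
            congr 1
            push_cast
            ring
    have h4 : ∑' j, ENNReal.ofReal (θ₀ (j + D) ^ 2) ≤
        ENNReal.ofReal (Q ^ 2 * (2 * Real.exp 1) ^ (2 * α) * r ^ (-(2 * α))) := by
      refine (tsum_sq_tail_le_of_mem_sobolevBall hα hθ₀ D).trans (ENNReal.ofReal_le_ofReal ?_)
      rw [mul_assoc]
      gcongr
      exact rpow_headSize_le (by linarith) hr0 hJ2
    rw [hB, Set.mem_ofPred_eq, tsum_ofReal_eq_sum_add _ (fun j => sq_nonneg _) D]
    calc _ ≤ ENNReal.ofReal (r ^ (-(2 * α))) + (2 * τ + 2 *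
          ENNReal.ofReal (Q ^ 2 * (2 * Real.exp 1) ^ (2 * α) * r ^ (-(2 * α)))) := by
          refine add_le_add (ENNReal.ofReal_le_ofReal h3) ((tsum_sq_sub_le θ θ₀ D).trans ?_)
          gcongr
      _ = _ := by
          rw [hτ, show (2 : ℝ≥0∞) = ENNReal.ofReal 2 by simp, ← ENNReal.ofReal_mul (by norm_num),
            ← ENNReal.ofReal_mul (by norm_num),
            ← ENNReal.ofReal_add (by positivity) (by positivity),
            ← ENNReal.ofReal_add (by positivity) (by positivity)]
          congr 1
          ring
  -- Truncated subtraction makes the bound trivial when the tail scales are large.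
  have hhead : ∀ A ∈ (Finset.range J : Set ℕ).pi I,
      ENNReal.ofReal (Real.exp (-(C₃ * r))) *
        (1 - (∑' j, ENNReal.ofReal (A (blockIndex (j + D + 1)))) / τ) ≤ blockGaussian A B := by
    intro A hA
    refine le_trans ?_ (measure_mono hsub)
    refine le_trans ?_ (infinitePi_pi_inter_tail_ge
      (fun j => Real.toNNReal (A (blockIndex (j + 1)))) D (fun i => measurableSet_Icc) τ)
    refine mul_le_mul ?_ le_rfl zero_le zero_le
    rw [Measure.infinitePi_pi _ (fun i _ => measurableSet_Icc)]
    refine (ENNReal.ofReal_le_ofReal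
      (exp_neg_le_prod_window hK₂0 hα hL1 hr hDr hθ₀)).trans ?_
    rw [ENNReal.ofReal_prod_of_nonneg fun j _ => by positivity]
    refine Finset.prod_le_prod' fun j hj => ?_
    have hjD : j < D := Finset.mem_range.1 hj
    have hj' : (j : ℝ) + 1 ≤ D := by exact_mod_cast hjD
    exact gaussianReal_window_ge hK hβ hr (hj'.trans hDr) (θ₀ j)
      (hA _ (by simpa using blockIndex_lt_of_lt_headSize hjD))
  set PA := Measure.infinitePi g.scaleLaw with hPA
  have hIm : MeasurableSet ((Finset.range J : Set ℕ).pi I) :=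
    MeasurableSet.pi (Finset.range J).countable_toSet fun i _ => measurableSet_Icc
  have hPI : ENNReal.ofReal (Real.exp (-(K * r))) ≤ PA ((Finset.range J : Set ℕ).pi I) := by
    rw [hPA, Measure.infinitePi_pi _ (fun i _ => measurableSet_Icc)]
    refine le_trans ?_ (Finset.prod_le_prod' fun k _ => hwin k)
    rw [← ENNReal.ofReal_prod_of_nonneg (fun _ _ => Real.exp_nonneg _), ← Real.exp_sum,
      Finset.sum_neg_distrib, ← Finset.mul_sum]
    have := (sum_range_exp_le J).trans hJ1
    gcongr
  have hτ0 : τ ≠ 0 := by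
    rw [hτ, Ne, ENNReal.ofReal_eq_zero, not_le]
    positivity
  have hfm : Measurable fun A : ℕ → ℝ => (∑' j, ENNReal.ofReal (A (blockIndex (j + D + 1)))) / τ :=
    (Measurable.tsum fun j => by fun_prop).div_const _
  have hmeanI : ∫⁻ A in (Finset.range J : Set ℕ).pi I,
      (∑' j, ENNReal.ofReal (A (blockIndex (j + D + 1)))) / τ ∂PA ≤
        PA ((Finset.range J : Set ℕ).pi I) * 2⁻¹ := by
    simp_rw [ENNReal.div_eq_inv_mul]
    rw [lintegral_const_mul _ (Measurable.tsum fun j => by fun_prop),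
      lintegral_tsum fun j => Measurable.aemeasurable (by fun_prop)]
    have h1 : ∀ j, ∫⁻ A in (Finset.range J : Set ℕ).pi I,
        ENNReal.ofReal (A (blockIndex (j + D + 1))) ∂PA ≤ PA ((Finset.range J : Set ℕ).pi I) *
          (4 * ENNReal.ofReal (Real.exp (-c₂ * (blockIndex (j + D + 1) : ℝ) ^ 2))) := by
      intro j
      rw [setLIntegral_pi_eval (Finset.range J) (fun i => measurableSet_Icc)
        (i := blockIndex (j + D + 1))
        (by simpa using le_blockIndex_of_headSize_le (Nat.le_add_left D j))
        ENNReal.measurable_ofReal, lintegral_scaleLaw]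
      gcongr
      refine (hmean _).trans (le_of_eq ?_)
      rw [ENNReal.ofReal_mul (by norm_num)]
      simp
    calc _ ≤ τ⁻¹ * ∑' j, PA ((Finset.range J : Set ℕ).pi I) *
          (4 * ENNReal.ofReal (Real.exp (-c₂ * (blockIndex (j + D + 1) : ℝ) ^ 2))) := by
          gcongr with j
          exact h1 j
      _ ≤ τ⁻¹ * (PA ((Finset.range J : Set ℕ).pi I) *
            (4 * ENNReal.ofReal (C₁ * r ^ (-(2 * α))))) := by
          rw [ENNReal.tsum_mul_left, ENNReal.tsum_mul_left]
          gcongr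
          exact htail J r hr0 hJ2
      _ = PA ((Finset.range J : Set ℕ).pi I) * (τ⁻¹ * (τ * 2⁻¹)) := by
          have : 4 * ENNReal.ofReal (C₁ * r ^ (-(2 * α))) = τ * 2⁻¹ := by
            rw [hτ, ← ENNReal.div_eq_inv_mul.trans (mul_comm _ _),
              ENNReal.eq_div_iff (by norm_num) (by norm_num), hT, ← mul_assoc,
              show (2 : ℝ≥0∞) * 4 = ENNReal.ofReal 8 by norm_num,
              ← ENNReal.ofReal_mul (by norm_num), mul_assoc]
          rw [this]
          ring
      _ = _ := by
          rw [← mul_assoc τ⁻¹, ENNReal.inv_mul_cancel hτ0 ENNReal.ofReal_ne_top, one_mul]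
  rw [blockPrior_apply g hBm]
  calc ENNReal.ofReal (Real.exp (-((C₃ + K + 1) * r)))
      ≤ ENNReal.ofReal (Real.exp (-(C₃ * r))) *
          (ENNReal.ofReal (Real.exp (-(K * r))) * 2⁻¹) := by
        rw [show (2⁻¹ : ℝ≥0∞) = ENNReal.ofReal 2⁻¹ by
          rw [ENNReal.ofReal_inv_of_pos (by norm_num)]; simp,
          ← ENNReal.ofReal_mul (Real.exp_nonneg _), ← ENNReal.ofReal_mul (Real.exp_nonneg _)]
        refine ENNReal.ofReal_le_ofReal ?_
        have h1 : Real.exp (-r) ≤ 2⁻¹ := by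
          rw [Real.exp_neg]
          gcongr
          linarith [Real.add_one_le_exp r]
        calc _ = Real.exp (-(C₃ * r)) * (Real.exp (-(K * r)) * Real.exp (-r)) := by
              rw [← Real.exp_add, ← Real.exp_add]
              congr 1
              ring
          _ ≤ _ := by gcongr
    _ ≤ ENNReal.ofReal (Real.exp (-(C₃ * r))) *
          (PA ((Finset.range J : Set ℕ).pi I) - PA ((Finset.range J : Set ℕ).pi I) * 2⁻¹) := by
        gcongr
        refine (mul_le_mul_left hPI _).trans (le_of_eq ?_)
        refine ENNReal.eq_sub_of_add_eq ?_ ?_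
        · exact ENNReal.mul_ne_top (measure_ne_top _ _) (by norm_num)
        · rw [← mul_add, ENNReal.inv_two_add_inv_two, mul_one]
    _ ≤ ENNReal.ofReal (Real.exp (-(C₃ * r))) * ∫⁻ A in (Finset.range J : Set ℕ).pi I,
          (1 - (∑' j, ENNReal.ofReal (A (blockIndex (j + D + 1)))) / τ) ∂PA := by
        gcongr
        refine le_trans ?_ (lintegral_sub_le _ _ hfm)
        rw [setLIntegral_one]
        gcongr
    _ = ∫⁻ A in (Finset.range J : Set ℕ).pi I, ENNReal.ofReal (Real.exp (-(C₃ * r))) *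
          (1 - (∑' j, ENNReal.ofReal (A (blockIndex (j + D + 1)))) / τ) ∂PA := by
        rw [lintegral_const_mul' _ _ ENNReal.ofReal_ne_top]
    _ ≤ ∫⁻ A in (Finset.range J : Set ℕ).pi I, blockGaussian A B ∂PA :=
        setLIntegral_mono' hIm hhead
    _ ≤ _ := setLIntegral_le_lintegral _ _

/-! ### The sieve -/

/-- The Chernoff bound for finite partial sums is uniform in their length, so it passes to the
increasing union. -/
theorem blockGaussian_tail_le {A : ℕ → ℝ} {k : ℕ} {l V u b : ℝ} (hl : 0 ≤ l) (hu : 0 ≤ u)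
    (hV : 0 ≤ V)
    (hA : ∀ j ≥ headSize k, A (blockIndex (j + 1)) ≤ b) (hb0 : 0 ≤ b) (hb : l * b ≤ 1 / 4)
    (hsum : ∑' j, ENNReal.ofReal (A (blockIndex (j + headSize k + 1))) ≤ ENNReal.ofReal V) :
    blockGaussian A {θ | ENNReal.ofReal u < ∑' j, ENNReal.ofReal (θ (j + headSize k) ^ 2)} ≤
      ENNReal.ofReal (Real.exp (-(l * u) + 2 * l * V)) := by
  set D := headSize k
  set E : ℕ → Set (ℕ → ℝ) := fun N => {θ | u < ∑ j ∈ Finset.Ico D (N + D), (θ j - 0) ^ 2} with hE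
  have hsub : {θ : ℕ → ℝ | ENNReal.ofReal u < ∑' j, ENNReal.ofReal (θ (j + D) ^ 2)} ⊆ ⋃ N, E N := by
    intro θ hθ
    rw [Set.mem_ofPred_eq, ENNReal.tsum_eq_iSup_nat, lt_iSup_iff] at hθ
    obtain ⟨N, hN⟩ := hθ
    rw [← ENNReal.ofReal_sum_of_nonneg (fun j _ => sq_nonneg _),
      ENNReal.ofReal_lt_ofReal_iff_of_nonneg hu] at hN
    refine Set.mem_iUnion.2 ⟨N, hN.trans_le (le_of_eq ?_)⟩
    rw [Finset.sum_Ico_eq_sum_range, Nat.add_sub_cancel]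
    exact Finset.sum_congr rfl fun j _ => by rw [sub_zero, add_comm]
  have hmono : Monotone E := by
    intro a b hab θ hθ
    have hθ' : u < ∑ j ∈ Finset.Ico D (a + D), (θ j - 0) ^ 2 := hθ
    refine lt_of_lt_of_le hθ' (Finset.sum_le_sum_of_subset_of_nonneg ?_ fun _ _ _ => sq_nonneg _)
    exact Finset.Ico_subset_Ico_right (by omega)
  refine (measure_mono hsub).trans ?_
  rw [hmono.measure_iUnion]
  refine iSup_le fun N => ?_
  refine (infinitePi_gaussianReal_sum_sq_gt_le (fun _ => 0)
    (fun j => Real.toNNReal (A (blockIndex (j + 1)))) (Finset.Ico D (N + D)) hl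
    (fun j hj => ?_) u).trans (ENNReal.ofReal_le_ofReal (Real.exp_le_exp.2 ?_))
  · refine le_trans ?_ hb
    gcongr
    rw [Real.coe_toNNReal']
    exact max_le (hA j (Finset.mem_Ico.1 hj).1) hb0
  · gcongr
    have h1 := (ENNReal.sum_le_tsum (Finset.range N)).trans hsum
    have h2 : ENNReal.ofReal (∑ j ∈ Finset.Ico D (N + D),
        ((Real.toNNReal (A (blockIndex (j + 1))) : ℝ≥0) : ℝ)) ≤ ENNReal.ofReal V := by
      rw [ENNReal.ofReal_sum_of_nonneg (fun _ _ => NNReal.coe_nonneg _),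
        Finset.sum_Ico_eq_sum_range, Nat.add_sub_cancel]
      refine le_trans (le_of_eq (Finset.sum_congr rfl fun j _ => ?_)) h1
      rw [ENNReal.ofReal_coe_nnreal, add_comm D j]
      rfl
    exact (ENNReal.ofReal_le_ofReal_iff hV).1 h2

/-- A union bound over the late blocks; e^{k+i} ≥ e^k + i makes the series geometric. -/
theorem exists_infinitePi_scaleLaw_exceed_le {g : MixingDensities} (hg : InMixingClass g) :
    ∃ c₃ : ℝ, 0 < c₃ ∧ ∃ C : ℝ, 0 < C ∧ ∀ k : ℕ, Measure.infinitePi g.scaleLaw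
      {A | ∃ i : ℕ, Real.exp (-((k + i : ℕ) : ℝ) ^ 2) < A (k + i)} ≤
        ENNReal.ofReal (C * Real.exp (-(c₃ * Real.exp k))) := by
  obtain ⟨c₃, hc₃, htail⟩ := hg.tail
  have hs : Summable fun i : ℕ => Real.exp (i * (-c₃)) :=
    Real.summable_exp_nat_mul_iff.2 (by linarith)
  refine ⟨c₃, hc₃, ∑' i : ℕ, Real.exp (i * (-c₃)), hs.tsum_pos (fun _ => Real.exp_nonneg _) 0
    (Real.exp_pos _), fun k => ?_⟩
  have hU : {A : ℕ → ℝ | ∃ i : ℕ, Real.exp (-((k + i : ℕ) : ℝ) ^ 2) < A (k + i)} =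
      ⋃ i : ℕ, (fun A : ℕ → ℝ => A (k + i)) ⁻¹' Set.Ioi (Real.exp (-((k + i : ℕ) : ℝ) ^ 2)) := by
    ext A
    simp
  rw [hU]
  calc _ ≤ ∑' i : ℕ, ENNReal.ofReal (Real.exp (i * (-c₃))) *
        ENNReal.ofReal (Real.exp (-(c₃ * Real.exp k))) := by
        refine (measure_iUnion_le _).trans (ENNReal.tsum_le_tsum fun i => ?_)
        rw [(measurePreserving_eval_infinitePi g.scaleLaw (k + i)).measure_preimage
          measurableSet_Ioi.nullMeasurableSet]
        refine (scaleLaw_Ioi_exp_le (htail (k + i))).trans ?_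
        rw [← ENNReal.ofReal_mul (Real.exp_nonneg _), ← Real.exp_add]
        refine ENNReal.ofReal_le_ofReal (Real.exp_le_exp.2 ?_)
        have h1 : Real.exp k + i ≤ Real.exp ((k + i : ℕ) : ℝ) := by
          push_cast
          rw [Real.exp_add]
          have h2 := Real.add_one_le_exp (i : ℝ)
          have h3 := Real.one_le_exp (Nat.cast_nonneg (α := ℝ) k)
          have h4 : (0 : ℝ) ≤ i := Nat.cast_nonneg i
          nlinarith
        nlinarith
    _ = _ := by
        rw [ENNReal.tsum_mul_right, ENNReal.ofReal_mul (tsum_nonneg fun _ => Real.exp_nonneg _),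
          ENNReal.ofReal_tsum_of_nonneg (fun _ => Real.exp_nonneg _) hs]

/-- Outside a set of prior mass of order `e^{-Lr}`, the coordinates beyond a multiple of `r` have
squared norm of order `r^{-2α}`. -/
theorem exists_blockPrior_tail_le {g : MixingDensities} (hg : InMixingClass g) {α : ℝ}
    (hα : 0 < α) : ∃ U : ℝ, 0 < U ∧ ∀ L : ℝ, 0 < L → ∃ s : ℕ, ∃ C : ℝ, 0 < C ∧ ∃ r₀ : ℝ,
      ∀ r : ℝ, 1 ≤ r → r₀ ≤ r → ∀ J : ℕ, r ≤ Real.exp ((J : ℝ) + 1) →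
        blockPrior g {θ | ENNReal.ofReal (U * r ^ (-(2 * α))) <
          ∑' j, ENNReal.ofReal (θ (j + headSize (J + s)) ^ 2)} ≤
        ENNReal.ofReal (C * Real.exp (-(L * r))) := by
  obtain ⟨c₃, hc₃, C₃, hC₃, hexc⟩ := exists_infinitePi_scaleLaw_exceed_le hg
  obtain ⟨C₁, hC₁, hdecay⟩ :=
    exists_exp_neg_blockIndex_sq_le one_pos (q := 2 * α + 2) (by linarith)
  obtain ⟨C₂, hC₂, htail⟩ :=
    exists_tsum_exp_neg_blockIndex_sq_tail_le one_pos (a := 2 * α) (by linarith)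
  -- The Chernoff exponent is -(2C₂+1)Lr + 2C₂Lr = -Lr, so U does not depend on L. The shift `s`
  -- ensures c₃e^{J+s} ≥ Lr; its extra 1 comes from r ≤ e^{J+1}.
  refine ⟨2 * C₂ + 1, by positivity, fun L hL => ⟨⌈L / c₃⌉₊ + 1, C₃ + 1, by positivity,
    4 * (L * (C₁ * (2 * Real.exp 1) ^ (2 * α + 2))), fun r hr hr₀ J hJ => ?_⟩⟩
  have hr0 : 0 < r := by linarith
  set s := ⌈L / c₃⌉₊ + 1 with hs
  set k := J + s with hk
  have hks : (k : ℝ) = (J : ℝ) + 1 + ⌈L / c₃⌉₊ := by rw [hk, hs]; push_cast; ring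
  have hrk : L * r ≤ c₃ * Real.exp k := by
    rw [hks, Real.exp_add]
    have h1 : L / c₃ ≤ Real.exp ⌈L / c₃⌉₊ :=
      (Nat.le_ceil _).trans (by linarith [Real.add_one_le_exp (⌈L / c₃⌉₊ : ℝ)])
    rw [div_le_iff₀ hc₃] at h1
    calc L * r ≤ (Real.exp ⌈L / c₃⌉₊ * c₃) * Real.exp ((J : ℝ) + 1) := by gcongr
      _ = _ := by ring
  have hrk' : r ≤ Real.exp ((k : ℝ) + 1) := by
    refine hJ.trans (Real.exp_le_exp.2 ?_)
    rw [hks]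
    linarith [Nat.cast_nonneg (α := ℝ) ⌈L / c₃⌉₊]
  set D := headSize k with hD
  set S := {θ : ℕ → ℝ | ENNReal.ofReal ((2 * C₂ + 1) * r ^ (-(2 * α))) <
          ∑' j, ENNReal.ofReal (θ (j + D) ^ 2)} with hS
  have hSm : MeasurableSet S := measurableSet_lt measurable_const (measurable_tsum_sq_tail D)
  set G := {A : ℕ → ℝ | ∃ i : ℕ, Real.exp (-((k + i : ℕ) : ℝ) ^ 2) < A (k + i)} with hG
  have hGm : MeasurableSet G := by
    rw [hG, Set.ofPred_exists]
    exact MeasurableSet.iUnion fun i => measurableSet_lt measurable_const (measurable_pi_apply _)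
  have hpow : r ^ (2 * α + 1) * r ^ (-(2 * α)) = r := by
    rw [← Real.rpow_add hr0]
    ring_nf
    exact Real.rpow_one r
  have hgood : ∀ A, A ∉ G → blockGaussian A S ≤ ENNReal.ofReal (Real.exp (-(L * r))) := by
    intro A hA
    have hA' : ∀ m ≥ k, A m ≤ Real.exp (-1 * (m : ℝ) ^ 2) := by
      intro m hm
      by_contra! h
      refine hA ⟨m - k, ?_⟩
      rw [Nat.add_sub_cancel' hm]
      rwa [neg_one_mul] at h
    have hle : ∀ j ≥ D, A (blockIndex (j + 1)) ≤
        C₁ * ((2 * Real.exp 1) ^ (2 * α + 2) * r ^ (-(2 * α + 2))) := by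
      intro j hj
      refine (hA' _ (le_blockIndex_of_headSize_le hj)).trans ((hdecay j).trans ?_)
      gcongr
      refine le_trans ?_ (rpow_headSize_le (by linarith) hr0 hrk')
      have : (D : ℝ) ≤ j := by exact_mod_cast hj
      exact Real.rpow_le_rpow_of_nonpos (by positivity) (by linarith) (by linarith)
    -- So large an `l` is admissible because the late variances are O(r^{-(2α+2)}), so their product
    -- with `l` is O(1/r); `r₀` makes it at most 1/4.
    refine (blockGaussian_tail_le (l := L * r ^ (2 * α + 1)) (V := C₂ * r ^ (-(2 * α)))
      (by positivity) (by positivity) (by positivity) hle (by positivity) ?_ ?_).trans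
      (ENNReal.ofReal_le_ofReal (Real.exp_le_exp.2 (le_of_eq ?_)))
    · have h1 : r ^ (2 * α + 1) * r ^ (-(2 * α + 2)) = r⁻¹ := by
        rw [← Real.rpow_add hr0, ← Real.rpow_neg_one]
        ring_nf
      calc _ = L * (C₁ * (2 * Real.exp 1) ^ (2 * α + 2)) *
            (r ^ (2 * α + 1) * r ^ (-(2 * α + 2))) := by ring
        _ ≤ 1 / 4 := by
          rw [h1, ← div_eq_mul_inv, div_le_iff₀ hr0]
          linarith
    · refine le_trans (ENNReal.tsum_le_tsum fun j => ENNReal.ofReal_le_ofReal ?_)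
        (htail k r hr0 hrk')
      exact hA' _ (le_blockIndex_of_headSize_le (Nat.le_add_left D j))
    · calc _ = -(L * (r ^ (2 * α + 1) * r ^ (-(2 * α)))) := by ring
        _ = _ := by rw [hpow]
  rw [blockPrior_apply g hSm]
  calc _ ≤ ∫⁻ A, (G.indicator 1 A + ENNReal.ofReal (Real.exp (-(L * r))))
        ∂(Measure.infinitePi g.scaleLaw) := by
        refine lintegral_mono fun A => ?_
        by_cases hA : A ∈ G
        · rw [Set.indicator_of_mem hA]
          exact prob_le_one.trans le_self_add
        · exact (hgood A hA).trans le_add_self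
    _ = Measure.infinitePi g.scaleLaw G + ENNReal.ofReal (Real.exp (-(L * r))) := by
        rw [lintegral_add_right _ measurable_const, lintegral_indicator_one hGm]
        simp
    _ ≤ ENNReal.ofReal (C₃ * Real.exp (-(L * r))) + ENNReal.ofReal (Real.exp (-(L * r))) := by
        gcongr
        refine (hexc k).trans (ENNReal.ofReal_le_ofReal ?_)
        gcongr
    _ = _ := by
        rw [← ENNReal.ofReal_add (by positivity) (by positivity)]
        congr 1
        ring

/-! ### Posterior contraction -/

theorem measurable_l2Norm_sub (θ₀ : ℕ → ℝ) : Measurable fun θ : ℕ → ℝ => l2Norm (θ - θ₀) :=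
  (measurable_tsum_sq_sub θ₀).pow_const _

theorem lt_tsum_sq_of_lt_l2Norm {a : ℝ} (ha : 0 ≤ a) {v : ℕ → ℝ}
    (h : ENNReal.ofReal a < l2Norm v) : ENNReal.ofReal (a ^ 2) < ∑' j, ENNReal.ofReal (v j ^ 2) := by
  by_contra! hle
  refine absurd h (not_lt.2 ?_)
  calc l2Norm v ≤ ENNReal.ofReal (a ^ 2) ^ (1 / 2 : ℝ) := by
        unfold l2Norm
        gcongr
    _ = ENNReal.ofReal a := by
        rw [ENNReal.ofReal_rpow_of_nonneg (sq_nonneg a) (by norm_num), ← Real.sqrt_eq_rpow,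
          Real.sqrt_sq ha]

theorem sum_sq_sub_le_of_tsum_le {θ θ₀ : ℕ → ℝ} {R : ℝ} (hR : 0 ≤ R)
    (h : ∑' j, ENNReal.ofReal ((θ j - θ₀ j) ^ 2) ≤ ENNReal.ofReal R) (I : Finset ℕ) :
    ∑ i ∈ I, (θ i - θ₀ i) ^ 2 ≤ R := by
  have h1 := (ENNReal.sum_le_tsum I).trans h
  rw [← ENNReal.ofReal_sum_of_nonneg (fun j _ => sq_nonneg _)] at h1
  exact (ENNReal.ofReal_le_ofReal_iff hR).1 h1

theorem seqModel_sum_sq_gt_le {n : ℕ} (hn : 1 ≤ n) (θ : ℕ → ℝ) (D : ℕ) (u : ℝ) :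
    seqModel n θ {x | u < ∑ j ∈ Finset.range D, (x j - θ j) ^ 2} ≤
      ENNReal.ofReal (Real.exp (-(n * u / 4) + D / 2)) := by
  have hn0 : (n : ℝ) ≠ 0 := by exact_mod_cast (by omega : n ≠ 0)
  refine (infinitePi_gaussianReal_sum_sq_gt_le θ (fun _ => (n : ℝ≥0)⁻¹) (Finset.range D)
    (l := n / 4) (by positivity) (fun j _ => le_of_eq ?_) u).trans
    (ENNReal.ofReal_le_ofReal (Real.exp_le_exp.2 (le_of_eq ?_)))
  · push_cast
    field_simp
  · simp only [Finset.sum_const, Finset.card_range, nsmul_eq_mul]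
    push_cast
    field_simp
    ring

/-- If `θ` is far from `θ₀` and both have small tails, then an observation that is close to `θ₀`
in the first coordinates is far from `θ`. -/
theorem lt_sum_sq_of_far {θ θ₀ x : ℕ → ℝ} {D : ℕ} {W U V : ℝ} (hW : 0 ≤ W) (hU : 0 ≤ U)
    (hV : 0 ≤ V)
    (hfar : ENNReal.ofReal (4 * W + 2 * U + 2 * V) < ∑' j, ENNReal.ofReal ((θ j - θ₀ j) ^ 2))
    (hθ : ∑' j, ENNReal.ofReal (θ (j + D) ^ 2) ≤ ENNReal.ofReal U)
    (hθ₀ : ∑' j, ENNReal.ofReal (θ₀ (j + D) ^ 2) ≤ ENNReal.ofReal V)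
    (hx : ∑ j ∈ Finset.range D, (x j - θ₀ j) ^ 2 ≤ W) :
    W < ∑ j ∈ Finset.range D, (x j - θ j) ^ 2 := by
  by_contra! hle
  refine absurd hfar (not_lt.2 ?_)
  have h1 : ∑ j ∈ Finset.range D, (θ j - θ₀ j) ^ 2 ≤ 4 * W := by
    calc _ ≤ ∑ j ∈ Finset.range D, (2 * (x j - θ j) ^ 2 + 2 * (x j - θ₀ j) ^ 2) :=
          Finset.sum_le_sum fun j _ => by nlinarith [sq_nonneg (2 * x j - θ j - θ₀ j)]
      _ ≤ 4 * W := by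
          rw [Finset.sum_add_distrib, ← Finset.mul_sum, ← Finset.mul_sum]
          linarith
  rw [tsum_ofReal_eq_sum_add _ (fun j => sq_nonneg _) D]
  calc _ ≤ ENNReal.ofReal (4 * W) + (2 * ENNReal.ofReal U + 2 * ENNReal.ofReal V) := by
        refine add_le_add (ENNReal.ofReal_le_ofReal h1) ((tsum_sq_sub_le θ θ₀ D).trans ?_)
        gcongr
    _ = _ := by
        rw [show (2 : ℝ≥0∞) = ENNReal.ofReal 2 by simp, ← ENNReal.ofReal_mul (by norm_num),
          ← ENNReal.ofReal_mul (by norm_num), ← ENNReal.ofReal_add (by positivity) (by positivity),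
          ← ENNReal.ofReal_add (by positivity) (by positivity)]
        congr 1
        ring

theorem exists_lintegral_posteriorProb_le {g : MixingDensities} (hg : InMixingClass g) {α Q : ℝ}
    (hα : 0 < α) : ∃ M : ℝ, 0 < M ∧ ∃ C : ℝ, ∃ r₀ : ℝ, ∀ n : ℕ, 1 ≤ n →
      r₀ ≤ (n : ℝ) ^ (1 / (2 * α + 1)) → ∀ θ₀ ∈ sobolevBall α Q,
        ∫⁻ x, posteriorProb n (blockPrior g) θ₀
          {θ | ENNReal.ofReal (M * rate α n) < l2Norm (θ - θ₀)} x ∂(seqModel n θ₀) ≤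
        ENNReal.ofReal (C * Real.exp (-(n : ℝ) ^ (1 / (2 * α + 1)))) := by
  obtain ⟨R, hR, C, hC, hmass⟩ := exists_blockPrior_nhd_ge hg (Q := Q) hα
  obtain ⟨U, hU, htail⟩ := exists_blockPrior_tail_le hg hα
  obtain ⟨s, C', hC', r₀, htail⟩ := htail (R + C + 2) (by positivity)
  -- With c = e^{-(R+C+1)r}, small evidence has probability at most e^{Rr}c/e^{-Cr} = e^{-r}, and
  -- c⁻¹e^{-Lr} = e^{-r}.
  set L := R + C + 2 with hL
  set V : ℝ := Q ^ 2 * (2 * Real.exp 1) ^ (2 * α) with hV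
  have hV0 : 0 ≤ V := by positivity
  -- Chosen so that Wr/4 - D/2 ≥ Lr, given D ≤ e^s r.
  set W : ℝ := 4 * L + 2 * Real.exp s with hW
  have hL0 : 0 < L := by positivity
  have hW0 : 0 < W := by positivity
  have hM : 0 < 4 * W + 2 * U + 2 * V := by positivity
  refine ⟨√(4 * W + 2 * U + 2 * V), Real.sqrt_pos.2 hM, C' + 3, r₀, fun n hn hr₀ θ₀ hθ₀ => ?_⟩
  have hβ : 0 < 2 * α + 1 := by linarith
  have hn1 : (1 : ℝ) ≤ n := by exact_mod_cast hn
  have hn0 : (0 : ℝ) < n := by linarith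
  set r : ℝ := (n : ℝ) ^ (1 / (2 * α + 1)) with hr
  have hr1 : 1 ≤ r := Real.one_le_rpow hn1 (by positivity)
  have hr0 : 0 < r := by linarith
  set e : ℝ := r ^ (-(2 * α)) with he
  have he0 : 0 < e := by positivity
  have hne : n * e = r := by
    rw [he, hr, ← Real.rpow_mul hn0.le]
    nth_rewrite 1 [← Real.rpow_one (n : ℝ)]
    rw [← Real.rpow_add hn0]
    congr 1
    field_simp
    ring
  have hrate : rate α n ^ 2 = e := by
    rw [rate, he, hr, ← Real.rpow_natCast, ← Real.rpow_mul hn0.le, ← Real.rpow_mul hn0.le]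
    congr 1
    push_cast
    field_simp
  have hrate0 : 0 ≤ rate α n := Real.rpow_nonneg hn0.le _
  set J := ⌊Real.log r⌋₊ with hJ
  have hJ1 : Real.exp J ≤ r := by
    rw [← Real.le_log_iff_exp_le hr0]
    exact Nat.floor_le (Real.log_nonneg hr1)
  have hJ2 : r ≤ Real.exp ((J : ℝ) + 1) := by
    rw [← Real.log_le_iff_le_exp hr0]
    exact (Nat.lt_floor_add_one _).le
  set D := headSize (J + s) with hD
  have hDr : (D : ℝ) ≤ Real.exp s * r := by
    refine (headSize_le_exp (J + s)).trans ?_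
    push_cast
    rw [Real.exp_add, mul_comm]
    gcongr
  have hθ₀tail : ∑' j, ENNReal.ofReal (θ₀ (j + D) ^ 2) ≤ ENNReal.ofReal (V * e) := by
    refine (tsum_sq_tail_le_of_mem_sobolevBall hα hθ₀ D).trans (ENNReal.ofReal_le_ofReal ?_)
    rw [hV, mul_assoc]
    gcongr
    refine rpow_headSize_le (by linarith) hr0 (hJ2.trans (Real.exp_le_exp.2 ?_))
    push_cast
    linarith [Nat.cast_nonneg (α := ℝ) s]
  have htest : ∀ θ : ℕ → ℝ, seqModel n θ {x | W * e < ∑ j ∈ Finset.range D, (x j - θ j) ^ 2} ≤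
      ENNReal.ofReal (Real.exp (-(L * r))) := by
    intro θ
    refine (seqModel_sum_sq_gt_le hn θ D (W * e)).trans
      (ENNReal.ofReal_le_ofReal (Real.exp_le_exp.2 ?_))
    have : n * (W * e) = W * r := by rw [← hne]; ring
    rw [this, hW]
    linarith
  set B := {θ : ℕ → ℝ | ∑' j, ENNReal.ofReal ((θ j - θ₀ j) ^ 2) ≤ ENNReal.ofReal (R * e)} with hB
  have hBm : MeasurableSet B := measurableSet_le (measurable_tsum_sq_sub θ₀) measurable_const
  have hmassB : ENNReal.ofReal (Real.exp (-(C * r))) ≤ blockPrior g B := hmass r hr1 θ₀ hθ₀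
  have hBpos : blockPrior g B ≠ 0 := by
    refine (lt_of_lt_of_le ?_ hmassB).ne'
    simp [Real.exp_pos]
  set G := {θ : ℕ → ℝ | ENNReal.ofReal (U * e) < ∑' j, ENNReal.ofReal (θ (j + D) ^ 2)} with hG
  have hGm : MeasurableSet G := measurableSet_lt measurable_const (measurable_tsum_sq_tail D)
  set S := {θ : ℕ → ℝ | ENNReal.ofReal (√(4 * W + 2 * U + 2 * V) * rate α n) < l2Norm (θ - θ₀)}
    with hS
  have hSm : MeasurableSet S := measurableSet_lt measurable_const (measurable_l2Norm_sub θ₀)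
  set Φ := {x : ℕ → ℝ | W * e < ∑ j ∈ Finset.range D, (x j - θ₀ j) ^ 2} with hΦ
  have hΦm : MeasurableSet Φ := measurableSet_lt measurable_const (by fun_prop)
  -- For far θ in the sieve, acceptance forces x to deviate from θ itself, so `htest` controls both
  -- error types.
  have hmiss : ∀ θ ∈ S, θ ∉ G → seqModel n θ Φᶜ ≤ ENNReal.ofReal (Real.exp (-(L * r))) := by
    intro θ hθS hθG
    refine (measure_mono fun x hx => ?_).trans (htest θ)
    have hfar := lt_tsum_sq_of_lt_l2Norm (mul_nonneg (Real.sqrt_nonneg _) hrate0) hθS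
    rw [mul_pow, Real.sq_sqrt hM.le, hrate,
      show (4 * W + 2 * U + 2 * V) * e = 4 * (W * e) + 2 * (U * e) + 2 * (V * e) by ring] at hfar
    rw [hG, Set.mem_ofPred_eq, not_lt] at hθG
    rw [Set.mem_compl_iff, hΦ, Set.mem_ofPred_eq, not_lt] at hx
    exact lt_sum_sq_of_far (by positivity) (by positivity) (by positivity) hfar hθG hθ₀tail hx
  set c : ℝ≥0∞ := ENNReal.ofReal (Real.exp (-((R + C + 1) * r))) with hc
  refine (lintegral_posteriorProb_le hn (blockPrior g) θ₀ hBm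
    (fun θ hθ => sum_sq_sub_le_of_tsum_le (by positivity) hθ) hBpos hSm hGm hΦm hmiss c).trans ?_
  have h1 : seqModel n θ₀ Φ ≤ ENNReal.ofReal (Real.exp (-r)) := by
    refine (htest θ₀).trans (ENNReal.ofReal_le_ofReal (Real.exp_le_exp.2 ?_))
    nlinarith
  have h2 : ENNReal.ofReal (Real.exp (n * (R * e))) * c / blockPrior g B ≤
      ENNReal.ofReal (Real.exp (-r)) := by
    refine ENNReal.div_le_of_le_mul (le_trans (le_of_eq ?_) (mul_le_mul_right hmassB _))
    rw [hc, ← ENNReal.ofReal_mul (Real.exp_nonneg _), ← ENNReal.ofReal_mul (Real.exp_nonneg _),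
      ← Real.exp_add, ← Real.exp_add, show n * (R * e) = R * (n * e) by ring, hne]
    congr 2
    ring
  have h3 : c⁻¹ * (blockPrior g G + ENNReal.ofReal (Real.exp (-(L * r)))) ≤
      ENNReal.ofReal ((C' + 1) * Real.exp (-r)) := by
    calc _ ≤ c⁻¹ * (ENNReal.ofReal (C' * Real.exp (-(L * r))) +
          ENNReal.ofReal (Real.exp (-(L * r)))) := by
          gcongr
          exact htail r hr1 hr₀ J hJ2
      _ = _ := by
          rw [hc, ← ENNReal.ofReal_inv_of_pos (Real.exp_pos _), ← Real.exp_neg, neg_neg,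
            ← ENNReal.ofReal_add (by positivity) (by positivity),
            ← ENNReal.ofReal_mul (Real.exp_nonneg _), ← add_one_mul, mul_left_comm,
            ← Real.exp_add]
          congr 3
          rw [hL]
          ring
  calc _ ≤ ENNReal.ofReal (Real.exp (-r)) + ENNReal.ofReal (Real.exp (-r)) +
        ENNReal.ofReal ((C' + 1) * Real.exp (-r)) := by gcongr
    _ = _ := by
        rw [← ENNReal.ofReal_add (by positivity) (by positivity),
          ← ENNReal.ofReal_add (by positivity) (by positivity)]
        congr 1
        ring

end BlockPrior

theorem theorem3p3 (g : BlockPrior.MixingDensities) (hg : BlockPrior.InMixingClass g)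
    (α Q : ℝ) (hα : 0 < α) (hQ : 0 < Q) :
    (∀ n : ℕ, 1 ≤ n → ∀ θ₀ ∈ BlockPrior.sobolevBall α Q,
      ∀ᵐ x ∂(BlockPrior.seqModel n θ₀),
        0 < BlockPrior.evidence n (BlockPrior.blockPrior g) θ₀ x ∧
          BlockPrior.evidence n (BlockPrior.blockPrior g) θ₀ x < ∞) ∧
    ∃ M : ℝ, 0 < M ∧
      Tendsto
        (fun n : ℕ => ⨆ θ₀ ∈ BlockPrior.sobolevBall α Q,
          ∫⁻ x, BlockPrior.posteriorProb n (BlockPrior.blockPrior g) θ₀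
            {θ | ENNReal.ofReal (M * BlockPrior.rate α n) < BlockPrior.l2Norm (θ - θ₀)} x
            ∂(BlockPrior.seqModel n θ₀))
        atTop (𝓝 0) := by
  constructor
  · intro n hn θ₀ hθ₀
    obtain ⟨R, hR, C, -, hmass⟩ := BlockPrior.exists_blockPrior_nhd_ge hg (Q := Q) hα
    -- Any neighbourhood of positive mass at finite ℓ² distance will do here, so r = 1 serves for
    -- every n.
    have h1 := hmass 1 le_rfl θ₀ hθ₀
    simp only [Real.one_rpow, mul_one] at h1
    refine BlockPrior.ae_evidence_pos_lt_top hn (BlockPrior.blockPrior g) θ₀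
      (measurableSet_le (BlockPrior.measurable_tsum_sq_sub θ₀) measurable_const)
      (fun θ hθ => BlockPrior.sum_sq_sub_le_of_tsum_le hR.le hθ) (lt_of_lt_of_le ?_ h1).ne'
    simp [Real.exp_pos]
  · obtain ⟨M, hM, C, r₀, hpost⟩ := BlockPrior.exists_lintegral_posteriorProb_le hg (Q := Q) hα
    refine ⟨M, hM, ?_⟩
    have hr : Tendsto (fun n : ℕ => (n : ℝ) ^ (1 / (2 * α + 1))) atTop atTop :=
      (tendsto_rpow_atTop (by positivity)).comp tendsto_natCast_atTop_atTop
    have hlim : Tendsto (fun n : ℕ => ENNReal.ofReal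
        (C * Real.exp (-(n : ℝ) ^ (1 / (2 * α + 1))))) atTop (𝓝 0) := by
      rw [← ENNReal.ofReal_zero, ← mul_zero C]
      exact ENNReal.tendsto_ofReal
        ((Real.tendsto_exp_neg_atTop_nhds_zero.comp hr).const_mul C)
    refine tendsto_of_tendsto_of_tendsto_of_le_of_le' tendsto_const_nhds hlim
      (Eventually.of_forall fun _ => zero_le) ?_
    filter_upwards [hr.eventually_ge_atTop r₀, eventually_ge_atTop 1] with n hn hn1
    exact iSup₂_le fun θ₀ hθ₀ => hpost n hn1 hn θ₀ hθ₀
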